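/- Rings are associative, not necessarily unital. For a ring $R$ let $J(R)=\{x\in R:\forall y\,\exists z\;(yx+z+zyx=0)\}$ be its Jacobson radical; a subset $S\subseteq R$ is nilpotent if for some $m\ge 1$ all products $s_1\cdots s_m$ with $s_i\in S$ are $0$. A small profinite ring is a compact Hausdorff topological ring $R$ together with a distinguished countable basis of neighbourhoods of $0$ consisting of open (two-sided) ideals (equivalently, a presentation of $R$ as the limit of a countable inverse system of finite rings), and with a closed subgroup $\mathrm{Aut}^*(R)$ (for the topology of pointwise convergence) of the group of all ring automorphisms of $R$ fixing setwise each of these ideals, such that for every $n<\omega$ the group $\mathrm{Aut}^*(R)$ has only countably many orbits on $R^n$. For a prime $p$, let $F_0$ be the free commutative nil ring of nilexponent $p$ and characteristic $p$ on generators $(x_i)_{i<\omega}$, i.e. the quotient of the non-unital ring of polynomials over $\mathbb{F}_p$ in the variables $x_i$ with zero constant term by the ideal generated by the $p$-th powers of all its elements. For $n<\omega$ let $I_n$ be the ideal of $F_0$ generated by $\{x_i:i\ge n\}$, and let $F=F_{(p)}=\varprojlim_n F_0/I_n$, the inverse limit of the discrete rings $F_0/I_n$, as a topological ring. Corollary.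 Suppose that the conjecture "the Jacobson radical of every small profinite ring is nilpotent" fails in the class of commutative rings, i.e. there is a commutative small profinite ring whose Jacobson radical is not nilpotent. Then there are a commutative small profinite ring $R$ whose Jacobson radical is not nilpotent and a prime $p$ such that $F_{(p)}$ is topologically isomorphic (as a topological ring) to a closed subring of $R$. -/

import Mathlib

universe u

noncomputable section

namespace SmallProfinite

/-! ### Nilpotency and the Jacobson radical in rings without identity -/

/-- The product `r 0 * r 1 * ⋯ * r n` of `n + 1` elements of a ring, possibly without identity. -/
def prodUpTo {R : Type*} [Mul R] (r : ℕ → R) : ℕ → R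
  | 0 => r 0
  | n + 1 => prodUpTo r n * r (n + 1)

/-- A subset `S` (in practice an ideal) of a ring is nilpotent if, for some `m ≥ 1`,
all products of `m` elements of `S` vanish; here `m = n + 1`. -/
def IsNilpotentSet {R : Type*} [NonUnitalRing R] (S : Set R) : Prop :=
  ∃ n : ℕ, ∀ r : ℕ → R, (∀ i, r i ∈ S) → prodUpTo r n = 0

/-- The Jacobson radical of a ring, possibly without identity: the set of all `x` such that
every element of `R x` is left quasi-regular. -/
def jacobsonRadical (R : Type*) [NonUnitalRing R] : Set R :=
  {x | ∀ y : R, ∃ z : R, y * x + z + z * y * x = 0}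

/-! ### Small profinite rings -/

/-- The standard structural group of a ring with a distinguished family `B` of ideals: the
ring automorphisms fixing setwise every ideal of `B`. -/
def standardAut {R : Type*} [NonUnitalRing R] (B : Set (TwoSidedIdeal R)) :
    Subgroup (RingAut R) where
  carrier := {g | ∀ I ∈ B, ∀ x : R, g x ∈ I ↔ x ∈ I}
  mul_mem' := by
    intro f g hf hg I hI x
    exact (hf I hI (g x)).trans (hg I hI x)
  one_mem' := fun _ _ _ => Iff.rfl
  inv_mem' := by
    intro f hf I hI x
    have h := hf I hI (f⁻¹ x)
    have e : f (f⁻¹ x) = x := f.apply_symm_apply x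
    rw [e] at h
    exact h.symm

/-- The topology of pointwise convergence on the standard structural group. When `B` is a basis of
neighbourhoods of `0` this is also the topology of uniform convergence, because the elements of
the group preserve the members of `B`. -/
@[reducible] def standardAutTopology {R : Type*} [NonUnitalRing R] [TopologicalSpace R]
    (B : Set (TwoSidedIdeal R)) : TopologicalSpace (standardAut B) :=
  TopologicalSpace.induced (fun (g : standardAut B) (x : R) => (g : RingAut R) x)
    Pi.topologicalSpace

/-- A structure of small profinite ring on a compact Hausdorff topological ring `R`:
a distinguished countable basis of neighbourhoods of `0` consisting of open ideals (equivalently,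
a presentation of `R` as the limit of a countable inverse system of finite rings), and
a structural group, that is, a closed subgroup of the group of automorphisms fixing these ideals
setwise, having only countably many orbits on `n`-tuples for every `n`. -/
structure SmallProfiniteStructure (R : Type*) [NonUnitalRing R] [TopologicalSpace R]
    [IsTopologicalRing R] [CompactSpace R] [T2Space R] where
  basis : Set (TwoSidedIdeal R)
  basis_countable : basis.Countable
  basis_isOpen : ∀ I ∈ basis, IsOpen (I : Set R)
  basis_hasBasis : (nhds (0 : R)).HasBasis (fun I : TwoSidedIdeal R => I ∈ basis)
    (fun I => (I : Set R))
  structuralGroup : Subgroup (RingAut R)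
  structuralGroup_le : structuralGroup ≤ standardAut basis
  structuralGroup_closed :
    @IsClosed _ (standardAutTopology basis)
      {g : standardAut basis | (g : RingAut R) ∈ structuralGroup}
  countable_orbits : ∀ n : ℕ,
    (Set.range fun a : Fin n → R =>
      {b : Fin n → R | ∃ g ∈ structuralGroup, ∀ i, b i = g (a i)}).Countable

/-- The conjecture, for commutative rings, that the Jacobson radical of every small profinite
ring is nilpotent. -/
def CommNilpotentRadicalConjecture : Prop :=
  ∀ (R : Type u) [NonUnitalCommRing R] [TopologicalSpace R] [IsTopologicalRing R]
    [CompactSpace R] [T2Space R], SmallProfiniteStructure R →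
    IsNilpotentSet (jacobsonRadical R)

/-! ### The free commutative profinite nil ring of nilexponent and characteristic `p` -/

/-- The polynomials over `𝔽_p` in `x_0, x_1, …` without constant term. As a ring without identity,
this is the free commutative ring of characteristic `p` on the generators `x_i`. -/
abbrev PolyNoConst (p : ℕ) : Type :=
  RingHom.ker (MvPolynomial.constantCoeff : MvPolynomial ℕ (ZMod p) →+* ZMod p)

/-- The ideal generated by the `p`-th powers of all elements. -/
def powerIdeal (p : ℕ) : TwoSidedIdeal (PolyNoConst p) :=
  TwoSidedIdeal.span
    {f | ∃ g : PolyNoConst p, (f : MvPolynomial ℕ (ZMod p)) = (g : MvPolynomial ℕ (ZMod p)) ^ p}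

/-- The free commutative nil ring `F_0` of nilexponent `p` and characteristic `p` on the generators
`x_i`, `i < ω`: the quotient of the free commutative ring of characteristic `p` by the ideal
generated by all `p`-th powers. -/
abbrev FreeNil (p : ℕ) : Type := (powerIdeal p).ringCon.Quotient

/-- The generator `x_i` of `F_0`. -/
def FreeNil.x (p : ℕ) (i : ℕ) : FreeNil p :=
  ((⟨MvPolynomial.X i, by simp [RingHom.mem_ker]⟩ : PolyNoConst p) :
    (powerIdeal p).ringCon.Quotient)

/-- The ideal `I_n` of `F_0` generated by `x_i`, `i ≥ n`. -/
def tailIdeal (p n : ℕ) : TwoSidedIdeal (FreeNil p) :=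
  TwoSidedIdeal.span {a | ∃ i, n ≤ i ∧ a = FreeNil.x p i}

/-- The quotient ring `F_0 / I_n`, with the discrete topology. -/
def FreeNilQuot (p n : ℕ) : Type := (tailIdeal p n).ringCon.Quotient

instance (p n : ℕ) : NonUnitalCommRing (FreeNilQuot p n) :=
  inferInstanceAs (NonUnitalCommRing (tailIdeal p n).ringCon.Quotient)

instance (p n : ℕ) : TopologicalSpace (FreeNilQuot p n) := ⊥

instance (p n : ℕ) : DiscreteTopology (FreeNilQuot p n) := ⟨rfl⟩

theorem tailIdeal_anti (p : ℕ) {m n : ℕ} (h : m ≤ n) : tailIdeal p n ≤ tailIdeal p m :=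
  TwoSidedIdeal.span_mono fun _ ⟨i, hi, e⟩ => ⟨i, h.trans hi, e⟩

/-- The canonical map `F_0 / I_n → F_0 / I_m` for `m ≤ n`. -/
def FreeNilQuot.transition (p : ℕ) {m n : ℕ} (h : m ≤ n) :
    FreeNilQuot p n →ₙ+* FreeNilQuot p m where
  toFun := Quotient.map' id fun _ _ hab =>
    TwoSidedIdeal.ringCon_le_iff.mp (tailIdeal_anti p h) hab
  map_zero' := rfl
  map_add' := by rintro ⟨a⟩ ⟨b⟩; rfl
  map_mul' := by rintro ⟨a⟩ ⟨b⟩; rfl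

/-- The topological ring `F`, the inverse limit of the finite discrete rings `F_0 / I_n`, realised as
a subring of their product (and so carrying the subspace topology of the product topology). -/
def FreeProfiniteNil (p : ℕ) : NonUnitalSubring (∀ n, FreeNilQuot p n) where
  carrier := {f | ∀ (m n : ℕ) (h : m ≤ n), FreeNilQuot.transition p h (f n) = f m}
  zero_mem' := fun _ _ _ => map_zero _
  add_mem' := by
    intro f g hf hg m n h
    simp only [Pi.add_apply, map_add, hf m n h, hg m n h]
  neg_mem' := by
    intro f hf m n h
    simp only [Pi.neg_apply, map_neg, hf m n h]
  mul_mem' := by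
    intro f g hf hg m n h
    simp only [Pi.mul_apply, map_mul, hf m n h, hg m n h]

end SmallProfinite

end

noncomputable section
namespace SmallProfinite

/-! ### Baire category in compact groups -/

/-! Smallness enters only through local finiteness. The elements fixed by the stabilizer of `x` form
a closed subring that is countable, because there are countably many orbits on pairs; being compact,
it is finite by Baire (`finite_definableClosure`). Hence `R` has finite exponent and its Jacobson
radical is nil. If every `R/pR` had nilpotent radical, so would `R`; thus some `R/pR`, which is
again small, is a counterexample of characteristic `p`.

Adjoin an identity over `𝔽_p` to get a compact ring `A` whose nilradical is the radical of the ring.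
By Baire its nilexponent is bounded by some `p ^ k`, and a Frobenius kernel/image argument yields a
closed, multiplicatively closed, non-nilpotent subgroup `K` in which all `p`-th powers vanish
(`exists_nonnilpotent_of_nilexponent`).

Baire and polarization then give elements `a 0, a 1, …` of `K` tending to `0`, with all products `∏
a i ^ (p - 1)` nonzero (`exists_persistent_mul_pow`), and open ideals `U n` containing the later `a
i` and avoiding these products. Multiplying a polynomial by a suitable monomial turns one chosen
term into such a product and puts all other terms in `U n`. So evaluation at `a` pulls `U n` back to
exactly the tail ideal `I_n` (`exists_large_exponent_of_aeval_mem`), and passing to limits embeds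
the profinite ring (`exists_closed_embedding`). -/

/-- By Baire some `H n` has interior, so it and all later members are open; compactness applied to
this open tail leaves a single member. -/
theorem exists_eq_top_of_monotone_isClosed {X : Type*} [AddGroup X] [TopologicalSpace X]
    [IsTopologicalAddGroup X] [CompactSpace X] [T2Space X] (H : ℕ → AddSubgroup X)
    (hmono : Monotone H) (hclosed : ∀ n, IsClosed (H n : Set X)) (hcover : ∀ x, ∃ n, x ∈ H n) :
    ∃ n, H n = ⊤ := by
  obtain ⟨n, x, hx⟩ := nonempty_interior_of_iUnion_of_closed hclosed
    (Set.eq_univ_of_forall fun x => Set.mem_iUnion.2 (hcover x))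
  have hopen : IsOpen (H n : Set X) :=
    (H n).isOpen_of_mem_nhds (mem_interior_iff_mem_nhds.1 hx)
  have hopen' : ∀ m, IsOpen (H (n + m) : Set X) := fun m =>
    AddSubgroup.isOpen_mono (hmono (Nat.le_add_right n m)) hopen
  obtain ⟨m, hm⟩ := isCompact_univ.elim_directed_cover (fun m => (H (n + m) : Set X)) hopen'
    (fun x _ => by
      obtain ⟨k, hk⟩ := hcover x
      exact Set.mem_iUnion.2 ⟨k, hmono (Nat.le_add_left k n) hk⟩)
    (Monotone.directed_le fun a b hab => hmono (Nat.add_le_add_left hab n))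
  exact ⟨n + m, (AddSubgroup.eq_top_iff' _).2 fun x => hm (Set.mem_univ x)⟩

theorem finite_of_countable_of_compact {X : Type*} [AddGroup X] [TopologicalSpace X]
    [IsTopologicalAddGroup X] [CompactSpace X] [T2Space X] [Countable X] : Finite X := by
  obtain ⟨x, y, hy⟩ := nonempty_interior_of_iUnion_of_closed (f := fun x : X => ({x} : Set X))
    (fun x => isClosed_singleton) (Set.iUnion_of_singleton X)
  have hyx : y = x := interior_subset (s := ({x} : Set X)) hy
  subst hyx
  have hopen : IsOpen ({y} : Set X) := by
    rw [isOpen_iff_mem_nhds]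
    rintro z rfl
    exact mem_interior_iff_mem_nhds.1 hy
  have h0 : IsOpen ({0} : Set X) := by
    have := hopen.preimage (continuous_const_add y)
    convert this using 1
    ext z
    simp
  have : DiscreteTopology X := discreteTopology_of_isOpen_singleton_zero h0
  exact finite_of_compact_of_discrete

/-! ### Local finiteness of small profinite rings -/

namespace SmallProfiniteStructure

variable {R : Type*} [NonUnitalCommRing R] [TopologicalSpace R] [IsTopologicalRing R]
  [CompactSpace R] [T2Space R]

theorem continuous_of_mem (s : SmallProfiniteStructure R) {g : RingAut R}
    (hg : g ∈ s.structuralGroup) : Continuous g := by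
  refine continuous_of_continuousAt_zero g ?_
  rw [ContinuousAt, map_zero]
  refine (s.basis_hasBasis.tendsto_iff s.basis_hasBasis).2 fun I hI => ⟨I, hI, fun x hx => ?_⟩
  exact (s.structuralGroup_le hg I hI x).2 hx

/-- The subring of the elements fixed by the stabilizer of `x`. -/
def definableClosure (s : SmallProfiniteStructure R) (x : R) : NonUnitalSubring R where
  carrier := {y | ∀ g ∈ s.structuralGroup, g x = x → g y = y}
  zero_mem' := fun _ _ _ => map_zero _
  add_mem' := fun ha hb g hg hx => by rw [map_add, ha g hg hx, hb g hg hx]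
  neg_mem' := fun ha g hg hx => by rw [map_neg, ha g hg hx]
  mul_mem' := fun ha hb g hg hx => by rw [map_mul, ha g hg hx, hb g hg hx]

theorem mem_definableClosure (s : SmallProfiniteStructure R) (x : R) :
    x ∈ s.definableClosure x := fun _ _ h => h

theorem isClosed_definableClosure (s : SmallProfiniteStructure R) (x : R) :
    IsClosed (s.definableClosure x : Set R) := by
  have : (s.definableClosure x : Set R) =
      ⋂ g ∈ s.structuralGroup, ⋂ _ : g x = x, {y | g y = y} := by
    ext y
    simp only [Set.mem_iInter, Set.mem_ofPred_eq]
    rfl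
  rw [this]
  refine isClosed_iInter fun g => isClosed_iInter fun hg => isClosed_iInter fun _ => ?_
  exact isClosed_eq (s.continuous_of_mem hg) continuous_id

/-- The orbit of the pair `(x, y)` determines `y`: an automorphism carrying `(x, y)` to `(x, z)`
fixes `x`, hence fixes `y`. -/
theorem countable_definableClosure (s : SmallProfiniteStructure R) (x : R) :
    (s.definableClosure x : Set R).Countable := by
  let orbit : (Fin 2 → R) → Set (Fin 2 → R) := fun a =>
    {b | ∃ g ∈ s.structuralGroup, ∀ i, b i = g (a i)}
  refine Set.MapsTo.countable_of_injOn (f := fun y => orbit ![x, y]) (t := Set.range orbit)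
    (fun y _ => Set.mem_range_self _) ?_ (s.countable_orbits 2)
  intro y hy z _ hyz
  have hz : ![x, z] ∈ orbit ![x, y] := by
    have : ![x, z] ∈ orbit ![x, z] := ⟨1, one_mem _, fun i => rfl⟩
    simpa only [hyz] using this
  obtain ⟨g, hg, h⟩ := hz
  have h0 : x = g x := h 0
  have h1 : z = g y := h 1
  rw [h1, hy g hg h0.symm]

theorem finite_definableClosure (s : SmallProfiniteStructure R) (x : R) :
    Finite (s.definableClosure x) := by
  have : CompactSpace (s.definableClosure x) :=
    isCompact_iff_compactSpace.1 (s.isClosed_definableClosure x).isCompact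
  have : Countable (s.definableClosure x) := (s.countable_definableClosure x).to_subtype
  exact finite_of_countable_of_compact

/-- Each element lies in a finite subring, so it is torsion; Baire makes the torsion uniform.
Factorials make the kernels increasing. -/
theorem exists_exponent (s : SmallProfiniteStructure R) : ∃ N : ℕ, 0 < N ∧ ∀ x : R, N • x = 0 := by
  let H : ℕ → AddSubgroup R := fun n => (nsmulAddMonoidHom (α := R) n.factorial).ker
  have hH : ∀ n x, x ∈ H n ↔ n.factorial • x = 0 := fun n x => Iff.rfl
  obtain ⟨n, hn⟩ := exists_eq_top_of_monotone_isClosed H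
    (fun m n hmn x hx => by
      rw [hH] at hx ⊢
      obtain ⟨k, hk⟩ := Nat.factorial_dvd_factorial hmn
      rw [hk, mul_nsmul, hx, nsmul_zero])
    (fun n => isClosed_eq (continuous_nsmul _) continuous_const)
    (fun x => by
      have := s.finite_definableClosure x
      refine ⟨Nat.card (s.definableClosure x), ?_⟩
      rw [hH]
      obtain ⟨k, hk⟩ := Nat.dvd_factorial (Nat.card_pos (α := s.definableClosure x)) le_rfl
      have h := card_nsmul_eq_zero' (x := (⟨x, s.mem_definableClosure x⟩ : s.definableClosure x))
      rw [hk, mul_nsmul]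
      have h' := congrArg Subtype.val h
      have h'' : Nat.card (s.definableClosure x) • x = 0 := h'
      rw [h'', nsmul_zero])
  exact ⟨n.factorial, n.factorial_pos, fun x => (hH n x).1 (hn ▸ AddSubgroup.mem_top x)⟩

end SmallProfiniteStructure

/-! ### The Jacobson radical -/

/-- For fixed `y`, the admissible `x` form the projection of a closed subset of the compact space `R
× R`. -/
theorem isClosed_jacobsonRadical {R : Type*} [NonUnitalCommRing R] [TopologicalSpace R]
    [IsTopologicalRing R] [CompactSpace R] [T2Space R] : IsClosed (jacobsonRadical R) := by
  have : jacobsonRadical R =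
      ⋂ y : R, Prod.fst '' {q : R × R | y * q.1 + q.2 + q.2 * y * q.1 = 0} := by
    ext x
    simp [jacobsonRadical]
  rw [this]
  refine isClosed_iInter fun y => IsCompact.isClosed (IsCompact.image ?_ continuous_fst)
  exact (isClosed_eq (by fun_prop) continuous_const).isCompact

theorem map_mem_jacobsonRadical {R Q : Type*} [NonUnitalCommRing R] [NonUnitalCommRing Q]
    (π : R →ₙ+* Q) (hπ : Function.Surjective π) {x : R} (hx : x ∈ jacobsonRadical R) :
    π x ∈ jacobsonRadical Q := by
  intro y
  obtain ⟨y, rfl⟩ := hπ y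
  obtain ⟨z, hz⟩ := hx y
  exact ⟨π z, by simpa using congrArg π hz⟩

section Unitization

variable {k R : Type*} [CommRing k] [NonUnitalCommRing R] [Module k R] [IsScalarTower k R R]
  [SMulCommClass k R R]

theorem inr_prodUpTo (r : ℕ → R) (n : ℕ) :
    ((prodUpTo r n : R) : Unitization k R) = ∏ i ∈ Finset.range (n + 1), (r i : Unitization k R) := by
  induction n with
  | zero => simp [prodUpTo]
  | succ n ih => rw [Finset.prod_range_succ, ← ih, prodUpTo, Unitization.inr_mul]

theorem exists_inr_pow (x : R) (n : ℕ) :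
    ∃ y : R, (x : Unitization k R) ^ (n + 1) = (y : Unitization k R) :=
  ⟨prodUpTo (fun _ => x) n, by simp [inr_prodUpTo]⟩

theorem isUnit_one_add_inr_mul {x : R} (hx : x ∈ jacobsonRadical R) (y : R) :
    IsUnit (1 + (y : Unitization k R) * x) := by
  obtain ⟨z, hz⟩ := hx y
  refine IsUnit.of_mul_eq_one (1 + (z : Unitization k R)) ?_
  have h := congrArg (fun w : R => (w : Unitization k R)) hz
  simp only [Unitization.inr_add, Unitization.inr_mul, Unitization.inr_zero] at h
  linear_combination h

theorem mem_jacobsonRadical_of_isNilpotent [IsReduced k] {x : R}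
    (hx : IsNilpotent (x : Unitization k R)) : x ∈ jacobsonRadical R := by
  intro y
  have hu : IsUnit (1 + (y : Unitization k R) * x) :=
    (Commute.isNilpotent_mul_left (Commute.all _ _) hx).isUnit_one_add
  obtain ⟨v, hv⟩ := hu.exists_right_inv
  have hfst : v.fst = 1 := by simpa using congrArg (fun w : Unitization k R => w.fst) hv
  have hsnd := congrArg (fun w : Unitization k R => w.snd) hv
  refine ⟨v.snd, ?_⟩
  simp [hfst] at hsnd
  rw [← hsnd]
  rw [mul_assoc, mul_comm v.snd]
  abel

theorem isNilpotent_inr_of_mem_jacobsonRadical [TopologicalSpace R]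
    [IsTopologicalRing R] [CompactSpace R] [T2Space R] (s : SmallProfiniteStructure R) {x : R}
    (hx : x ∈ jacobsonRadical R) : IsNilpotent (x : Unitization k R) := by
  have hfin := s.finite_definableClosure x
  have hmem : ∀ n, prodUpTo (fun _ => x) n ∈ s.definableClosure x := by
    intro n
    induction n with
    | zero => exact s.mem_definableClosure x
    | succ n ih => exact mul_mem ih (s.mem_definableClosure x)
  -- Only odd powers are compared, so two equal ones differ by an even exponent `2 * (d + 1)`.
  -- Splitting off one factor `x` leaves `x ^ (2 * d + 1)`, which still lies in `R` and can serve as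
  -- the multiplier `y` in the definition of the radical.
  obtain ⟨i, j, hij, h⟩ := Finite.exists_ne_map_eq_of_infinite
    (fun n : ℕ => (⟨prodUpTo (fun _ => x) (2 * n), hmem _⟩ : s.definableClosure x))
  wlog hlt : i < j generalizing i j
  · exact this j i hij.symm h.symm (by omega)
  obtain ⟨d, rfl⟩ := Nat.exists_eq_add_of_lt hlt
  have h' := congrArg (fun w : R => (w : Unitization k R)) (congrArg Subtype.val h)
  simp only [inr_prodUpTo, Finset.prod_const, Finset.card_range] at h'
  obtain ⟨y, hy⟩ := exists_inr_pow (k := k) x (2 * d)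
  have hu := isUnit_one_add_inr_mul (k := k) hx (-y)
  refine ⟨2 * i + 1, ?_⟩
  have h0 : (x : Unitization k R) ^ (2 * i + 1) * (1 + ((-y : R) : Unitization k R) * x) = 0 := by
    rw [Unitization.inr_neg, ← hy]
    have e : 2 * (i + d + 1) + 1 = 2 * i + 1 + (2 * d + 1) + 1 := by ring
    rw [e] at h'
    have : (x : Unitization k R) ^ (2 * i + 1) = x ^ (2 * i + 1) * x ^ (2 * d + 1) * x := by
      rw [← pow_add, ← pow_succ]; exact h'
    linear_combination this
  exact (hu.mul_left_eq_zero).1 h0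

end Unitization

/-! ### Quotients of small profinite rings -/

section Quotient

variable {R Q : Type*} [NonUnitalCommRing R] [NonUnitalCommRing Q]

/-- The image of an ideal under a surjective homomorphism. -/
def imageIdeal (π : R →ₙ+* Q) (hπ : Function.Surjective π) (I : TwoSidedIdeal R) :
    TwoSidedIdeal Q :=
  TwoSidedIdeal.mk' (π '' I) ⟨0, I.zero_mem, map_zero π⟩
    (by rintro _ _ ⟨x, hx, rfl⟩ ⟨y, hy, rfl⟩; exact ⟨x + y, I.add_mem hx hy, map_add π x y⟩)
    (by rintro _ ⟨x, hx, rfl⟩; exact ⟨-x, I.neg_mem hx, map_neg π x⟩)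
    (by
      rintro q _ ⟨y, hy, rfl⟩
      obtain ⟨x, rfl⟩ := hπ q
      exact ⟨x * y, I.mul_mem_left x y hy, map_mul π x y⟩)
    (by
      rintro _ q ⟨x, hx, rfl⟩
      obtain ⟨y, rfl⟩ := hπ q
      exact ⟨x * y, I.mul_mem_right x y hx, map_mul π x y⟩)

theorem coe_imageIdeal (π : R →ₙ+* Q) (hπ : Function.Surjective π) (I : TwoSidedIdeal R) :
    (imageIdeal π hπ I : Set Q) = π '' I :=
  TwoSidedIdeal.coe_mk' _ _ _ _ _ _

theorem mem_imageIdeal {π : R →ₙ+* Q} {hπ : Function.Surjective π} {I : TwoSidedIdeal R} {q : Q} :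
    q ∈ imageIdeal π hπ I ↔ ∃ x ∈ I, π x = q := by
  rw [← SetLike.mem_coe, coe_imageIdeal]; rfl

/-- The automorphism of a quotient induced by an automorphism preserving the kernel. -/
def inducedAut (π : R →ₙ+* Q) (hπ : Function.Surjective π) (g : RingAut R)
    (hg : ∀ x, π x = 0 ↔ π (g x) = 0) : RingAut Q :=
  RingEquiv.ofBijective
    ({ toFun := fun q => π (g (Function.surjInv hπ q))
       map_zero' := (hg _).1 (Function.surjInv_eq hπ 0)
       map_add' := fun a b => by
        rw [← map_add, ← map_add, ← sub_eq_zero, ← map_sub, ← map_sub, ← hg]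
        simp [Function.surjInv_eq hπ]
       map_mul' := fun a b => by
        rw [← map_mul, ← map_mul, ← sub_eq_zero, ← map_sub, ← map_sub, ← hg]
        simp [Function.surjInv_eq hπ] } : Q →ₙ+* Q)
    ⟨(injective_iff_map_eq_zero _).2 fun q hq => by
      have := (hg _).2 hq
      rwa [Function.surjInv_eq hπ] at this,
    fun q => by
      obtain ⟨x, rfl⟩ := hπ q
      obtain ⟨y, rfl⟩ := g.surjective x
      refine ⟨π y, ?_⟩
      change π (g (Function.surjInv hπ (π y))) = π (g y)
      rw [← sub_eq_zero, ← map_sub, ← map_sub, ← hg]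
      simp [Function.surjInv_eq hπ]⟩

theorem inducedAut_apply (π : R →ₙ+* Q) (hπ : Function.Surjective π) (g : RingAut R)
    (hg : ∀ x, π x = 0 ↔ π (g x) = 0) (x : R) : inducedAut π hπ g hg (π x) = π (g x) := by
  change π (g (Function.surjInv hπ (π x))) = π (g x)
  rw [← sub_eq_zero, ← map_sub, ← map_sub, ← hg]
  simp [Function.surjInv_eq hπ]

variable [TopologicalSpace R] [IsTopologicalRing R] [CompactSpace R] [T2Space R]
  [TopologicalSpace Q] [IsTopologicalRing Q] [CompactSpace Q] [T2Space Q]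

/-- A quotient of a small profinite ring by an invariant closed ideal is small. -/
def SmallProfiniteStructure.map (s : SmallProfiniteStructure R) (π : R →ₙ+* Q)
    (hπ : IsOpenQuotientMap π)
    (hker : ∀ g ∈ s.structuralGroup, ∀ x, π x = 0 ↔ π (g x) = 0) : SmallProfiniteStructure Q where
  basis := imageIdeal π hπ.surjective '' s.basis
  basis_countable := s.basis_countable.image _
  basis_isOpen := by
    rintro _ ⟨I, hI, rfl⟩
    rw [coe_imageIdeal]
    exact hπ.isOpenMap _ (s.basis_isOpen I hI)
  basis_hasBasis := by
    have h := s.basis_hasBasis.map π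
    rw [hπ.map_nhds_eq, map_zero] at h
    refine h.to_hasBasis (fun I hI => ⟨_, ⟨I, hI, rfl⟩, (coe_imageIdeal _ _ _).subset⟩) ?_
    rintro _ ⟨I, hI, rfl⟩
    exact ⟨I, hI, (coe_imageIdeal _ _ _).symm.subset⟩
  -- Taking the full standard group rather than the group of induced automorphisms makes closedness
  -- trivial, and enlarging the group only merges orbits.
  structuralGroup := standardAut (imageIdeal π hπ.surjective '' s.basis)
  structuralGroup_le := le_rfl
  structuralGroup_closed := by
    let := standardAutTopology (imageIdeal π hπ.surjective '' s.basis)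
    convert isClosed_univ
    ext g
    simp
  countable_orbits := by
    intro n
    set H := standardAut (imageIdeal π hπ.surjective '' s.basis) with hH
    let F : Set (Fin n → R) → Set (Fin n → Q) := fun O =>
      {b | ∃ a ∈ O, ∃ h ∈ H, ∀ i, b i = h (π (a i))}
    refine ((s.countable_orbits n).image F).mono ?_
    rintro _ ⟨b, rfl⟩
    choose a ha using fun i => hπ.surjective (b i)
    obtain rfl : b = fun i => π (a i) := funext fun i => (ha i).symm
    refine ⟨_, ⟨a, rfl⟩, ?_⟩
    ext c
    constructor
    · rintro ⟨a', ⟨g, hg, hga⟩, h, hh, hc⟩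
      refine ⟨h * inducedAut π hπ.surjective g (hker g hg), mul_mem hh ?_, fun i => ?_⟩
      · rintro _ ⟨I, hI, rfl⟩ q
        obtain ⟨x, rfl⟩ := hπ.surjective q
        rw [inducedAut_apply, mem_imageIdeal, mem_imageIdeal]
        constructor
        · rintro ⟨y, hy, e⟩
          have e' := g.apply_symm_apply y
          refine ⟨g.symm y, (s.structuralGroup_le hg I hI _).1 (by rwa [e']), ?_⟩
          rw [← sub_eq_zero, ← map_sub, hker g hg, map_sub, map_sub, e', e, sub_self]
        · rintro ⟨y, hy, e⟩
          refine ⟨g y, (s.structuralGroup_le hg I hI y).2 hy, ?_⟩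
          rw [← sub_eq_zero, ← map_sub, ← map_sub, ← hker g hg, map_sub, e, sub_self]
      · rw [hc i, hga i, RingAut.mul_apply, inducedAut_apply]
    · rintro ⟨h, hh, hc⟩
      exact ⟨a, ⟨1, one_mem _, fun i => rfl⟩, h, hh, hc⟩

end Quotient

/-! ### Reduction to prime characteristic -/

section Reduction

variable {R : Type u} [NonUnitalCommRing R]

theorem prodUpTo_add (r : ℕ → R) (a b : ℕ) :
    prodUpTo r (a + b + 1) = prodUpTo r a * prodUpTo (fun i => r (a + 1 + i)) b := by
  induction b with
  | zero => rfl
  | succ b ih =>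
    change prodUpTo r (a + b + 1) * r (a + b + 1 + 1) = _
    rw [ih, mul_assoc]
    congr 2
    congr 1
    ring

theorem map_prodUpTo {Q : Type*} [NonUnitalCommRing Q] (π : R →ₙ+* Q) (r : ℕ → R) (n : ℕ) :
    π (prodUpTo r n) = prodUpTo (fun i => π (r i)) n := by
  induction n with
  | zero => rfl
  | succ n ih => rw [prodUpTo, prodUpTo, map_mul, ih]

/-- If long products from `S` lie in `mR` and in `nR`, concatenating two such products gives one in
`mnR`. Building up the exponent `N` from its prime factors this way makes long products vanish. -/
theorem isNilpotentSet_of_forall_prime (S : Set R) {N : ℕ} (hN : 0 < N) (hR : ∀ x : R, N • x = 0)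
    (h : ∀ p : ℕ, p.Prime → ∃ n : ℕ, ∀ r : ℕ → R, (∀ i, r i ∈ S) → ∃ y, prodUpTo r n = p • y) :
    IsNilpotentSet S := by
  suffices H : ∀ N : ℕ, 0 < N →
      ∃ n : ℕ, ∀ r : ℕ → R, (∀ i, r i ∈ S) → ∃ y, prodUpTo r n = N • y by
    obtain ⟨n, hn⟩ := H N hN
    refine ⟨n, fun r hr => ?_⟩
    obtain ⟨y, hy⟩ := hn r hr
    rw [hy, hR]
  intro N
  induction N using Nat.recOnPrimeCoprime with
  | zero => intro h; omega
  | prime_pow p k hp =>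
    intro _
    induction k with
    | zero => exact ⟨0, fun r _ => ⟨prodUpTo r 0, by simp⟩⟩
    | succ k ih =>
      obtain ⟨a, ha⟩ := ih (pow_pos hp.pos k)
      obtain ⟨b, hb⟩ := h p hp
      -- Index `n` means `n + 1` factors, so blocks of `a + 1` and `b + 1` factors have index `a + b
      -- + 1`.
      refine ⟨a + b + 1, fun r hr => ?_⟩
      obtain ⟨y, hy⟩ := ha r hr
      obtain ⟨z, hz⟩ := hb (fun i => r (a + 1 + i)) fun i => hr _
      exact ⟨y * z, by rw [prodUpTo_add, hy, hz, smul_mul_smul_comm, pow_succ]⟩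
  | coprime m n _ _ _ hm hn =>
    intro _
    obtain ⟨a, ha⟩ := hm (by omega)
    obtain ⟨b, hb⟩ := hn (by omega)
    refine ⟨a + b + 1, fun r hr => ?_⟩
    obtain ⟨y, hy⟩ := ha r hr
    obtain ⟨z, hz⟩ := hb (fun i => r (a + 1 + i)) fun i => hr _
    exact ⟨y * z, by rw [prodUpTo_add, hy, hz, smul_mul_smul_comm]⟩

/-- The ideal `nR`. -/
def multiplesIdeal (R : Type u) [NonUnitalCommRing R] (n : ℕ) : TwoSidedIdeal R :=
  TwoSidedIdeal.mk' (Set.range fun y : R => n • y) ⟨0, nsmul_zero n⟩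
    (by rintro _ _ ⟨x, rfl⟩ ⟨y, rfl⟩; exact ⟨x + y, nsmul_add x y n⟩)
    (by rintro _ ⟨x, rfl⟩; exact ⟨-x, neg_nsmul x n⟩)
    (by rintro x _ ⟨y, rfl⟩; exact ⟨x * y, (mul_smul_comm n x y).symm⟩)
    (by rintro _ y ⟨x, rfl⟩; exact ⟨x * y, (smul_mul_assoc n x y).symm⟩)

theorem mem_multiplesIdeal {n : ℕ} {x : R} : x ∈ multiplesIdeal R n ↔ ∃ y, n • y = x :=
  TwoSidedIdeal.mem_mk' _ _ _ _ _ _ _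

/-- The quotient map by an ideal. -/
def quotientHom (I : TwoSidedIdeal R) : R →ₙ+* I.ringCon.Quotient where
  toFun := fun x => (x : I.ringCon.Quotient)
  map_zero' := rfl
  map_add' := fun _ _ => rfl
  map_mul' := fun _ _ => rfl

theorem quotientHom_surjective (I : TwoSidedIdeal R) : Function.Surjective (quotientHom I) :=
  Quotient.mk''_surjective

theorem quotientHom_eq_iff {I : TwoSidedIdeal R} {x y : R} :
    quotientHom I x = quotientHom I y ↔ x - y ∈ I :=
  (RingCon.eq I.ringCon).trans (TwoSidedIdeal.rel_iff I x y)

theorem quotientHom_eq_zero {I : TwoSidedIdeal R} {x : R} : quotientHom I x = 0 ↔ x ∈ I := by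
  rw [← map_zero (quotientHom I), quotientHom_eq_iff, sub_zero]

/-- The quotient of a compact ring by a closed ideal is a compact ring. -/
theorem exists_topology_quotient [TopologicalSpace R] [IsTopologicalRing R] [CompactSpace R]
    (I : TwoSidedIdeal R) (hI : IsClosed (I : Set R)) :
    ∃ (_ : TopologicalSpace I.ringCon.Quotient), IsTopologicalRing I.ringCon.Quotient ∧
      CompactSpace I.ringCon.Quotient ∧ T2Space I.ringCon.Quotient ∧
      IsOpenQuotientMap (quotientHom I) := by
  let : TopologicalSpace I.ringCon.Quotient := TopologicalSpace.coinduced (quotientHom I) ‹_›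
  have hq : Topology.IsQuotientMap (quotientHom I) := ⟨⟨rfl⟩, quotientHom_surjective I⟩
  have ho : IsOpenQuotientMap (quotientHom I) := by
    refine ⟨hq.surjective, hq.continuous, fun U hU => ?_⟩
    rw [← hq.isOpen_preimage]
    have : quotientHom I ⁻¹' (quotientHom I '' U) = ⋃ y ∈ I, (fun x => y + x) ⁻¹' U := by
      ext x
      simp only [Set.mem_preimage, Set.mem_image, Set.mem_iUnion, exists_prop]
      constructor
      · rintro ⟨z, hz, e⟩
        exact ⟨z - x, quotientHom_eq_iff.1 e, by simpa using hz⟩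
      · rintro ⟨y, hy, h⟩
        exact ⟨y + x, h, quotientHom_eq_iff.2 (by simpa using hy)⟩
    rw [this]
    exact isOpen_biUnion fun y _ => hU.preimage (continuous_const_add y)
  refine ⟨inferInstance, ?_, ?_, ?_, ho⟩
  · have hadd : ContinuousAdd I.ringCon.Quotient := ⟨by
      rw [(ho.prodMap ho).isQuotientMap.continuous_iff]
      exact hq.continuous.comp continuous_add⟩
    have hmul : ContinuousMul I.ringCon.Quotient := ⟨by
      rw [(ho.prodMap ho).isQuotientMap.continuous_iff]
      exact hq.continuous.comp continuous_mul⟩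
    have hneg : ContinuousNeg I.ringCon.Quotient := ⟨by
      rw [hq.continuous_iff]
      exact hq.continuous.comp continuous_neg⟩
    exact { }
  · exact hq.surjective.compactSpace hq.continuous
  · rw [t2Space_iff_of_isOpenQuotientMap ho]
    have : {q : R × R | quotientHom I q.1 = quotientHom I q.2} =
        (fun q : R × R => q.1 - q.2) ⁻¹' (I : Set R) := by
      ext q
      exact quotientHom_eq_iff
    rw [this]
    exact hI.preimage (continuous_fst.sub continuous_snd)

theorem exists_small_of_prime_characteristic
    (hfail : ¬ CommNilpotentRadicalConjecture.{u}) :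
    ∃ (R : Type u) (_ : NonUnitalCommRing R) (_ : TopologicalSpace R) (_ : IsTopologicalRing R)
      (_ : CompactSpace R) (_ : T2Space R), Nonempty (SmallProfiniteStructure R) ∧
      ¬ IsNilpotentSet (jacobsonRadical R) ∧ ∃ p : ℕ, p.Prime ∧ ∀ x : R, p • x = 0 := by
  simp only [CommNilpotentRadicalConjecture, not_forall] at hfail
  obtain ⟨R, _, _, _, _, _, s, hs⟩ := hfail
  obtain ⟨N, hN, hR⟩ := s.exists_exponent
  by_contra hcon
  refine hs (isNilpotentSet_of_forall_prime _ hN hR fun p hp => ?_)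
  set I := multiplesIdeal R p with hIdef
  have hI : IsClosed (I : Set R) := by
    have : (I : Set R) = Set.range fun y : R => p • y := TwoSidedIdeal.coe_mk' _ _ _ _ _ _
    rw [this]
    exact (isCompact_range (continuous_nsmul p)).isClosed
  obtain ⟨_, h1, h2, h3, ho⟩ := exists_topology_quotient I hI
  have hker : ∀ g ∈ s.structuralGroup, ∀ x, quotientHom I x = 0 ↔ quotientHom I (g x) = 0 := by
    intro g _ x
    rw [quotientHom_eq_zero, quotientHom_eq_zero, mem_multiplesIdeal, mem_multiplesIdeal]
    constructor
    · rintro ⟨y, rfl⟩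
      exact ⟨g y, (map_nsmul g p y).symm⟩
    · rintro ⟨y, hy⟩
      refine ⟨g.symm y, g.injective ?_⟩
      rw [map_nsmul, g.apply_symm_apply, hy]
  have hnil : IsNilpotentSet (jacobsonRadical I.ringCon.Quotient) := by
    by_contra hn
    refine hcon ⟨I.ringCon.Quotient, inferInstance, inferInstance, h1, h2, h3,
      ⟨s.map (quotientHom I) ho hker⟩, hn, p, hp, fun q => ?_⟩
    obtain ⟨x, rfl⟩ := quotientHom_surjective I q
    rw [← map_nsmul, quotientHom_eq_zero]
    exact mem_multiplesIdeal.2 ⟨x, rfl⟩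
  obtain ⟨n, hn⟩ := hnil
  refine ⟨n, fun r hr => ?_⟩
  have := hn (fun i => quotientHom I (r i)) fun i =>
    map_mem_jacobsonRadical _ (quotientHom_surjective I) (hr i)
  rw [← map_prodUpTo, quotientHom_eq_zero] at this
  obtain ⟨y, hy⟩ := mem_multiplesIdeal.1 this
  exact ⟨y, hy.symm⟩

end Reduction

/-! ### Polarization in characteristic `p` -/

section Polarization

variable {p : ℕ} [Fact p.Prime]

/-- A power sum over `𝔽_p` is nonzero only for positive exponents divisible by `p - 1`. In the range
`i < p` this singles out `i = 1`, so weighting by `j ^ (p - 2)` extracts a linear coefficient. -/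
theorem sum_zmod_pow {i : ℕ} (hi : i < p) :
    ∑ j : ZMod p, j ^ (p - 2 + i) = if i = 1 then -1 else 0 := by
  have hp : 2 ≤ p := (Fact.out : p.Prime).two_le
  have hlt : ∀ i < p - 1, ∑ j : ZMod p, j ^ i = 0 := fun i h =>
    FiniteField.sum_pow_lt_card_sub_one (ZMod p) i (by rwa [ZMod.card])
  rcases i with _ | _ | i
  · simpa using hlt (p - 2) (by omega)
  · have e : p - 2 + (0 + 1) = p - 1 := by omega
    rw [e, if_pos rfl]
    have h1 : ∀ j : ZMod p, j ^ (p - 1) = 1 - if j = 0 then 1 else 0 := by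
      intro j
      split_ifs with h
      · rw [h, zero_pow (by omega), sub_self]
      · rw [ZMod.pow_card_sub_one_eq_one h, sub_zero]
    simp [h1, Finset.sum_sub_distrib, ZMod.card]
  · have e : p - 2 + (i + 1 + 1) = p + i := by omega
    rw [e, if_neg (by omega), ← hlt (i + 1) (by omega)]
    refine Finset.sum_congr rfl fun j _ => ?_
    rw [pow_add, ZMod.pow_card, pow_succ, mul_comm]

variable {A : Type*} [CommRing A] [CharP A p]

theorem sum_zmod_mul_add_pow (c y : A) {k : ℕ} (hk : k + 1 < p) :
    ∑ j : ZMod p, ZMod.castHom dvd_rfl A j ^ (p - 2) *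
      (ZMod.castHom dvd_rfl A j * y + c) ^ (k + 1) = -((k + 1 : ℕ) : A) * y * c ^ k := by
  have h : ∀ j : ZMod p, ZMod.castHom dvd_rfl A j ^ (p - 2) *
      (ZMod.castHom dvd_rfl A j * y + c) ^ (k + 1) =
      ∑ i ∈ Finset.range (k + 2), ZMod.castHom dvd_rfl A (j ^ (p - 2 + i)) *
        (y ^ i * c ^ (k + 1 - i) * ((k + 1).choose i : A)) := by
    intro j
    rw [add_pow, Finset.mul_sum]
    refine Finset.sum_congr rfl fun i _ => ?_
    rw [map_pow, pow_add, mul_pow]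
    ring
  simp_rw [h]
  rw [Finset.sum_comm]
  simp_rw [← Finset.sum_mul, ← map_sum]
  rw [Finset.sum_congr rfl fun i hi => by
    rw [sum_zmod_pow (p := p) (by have := Finset.mem_range.1 hi; omega)]]
  rw [Finset.sum_eq_single 1]
  · simp
    ring
  · intro i _ hi
    simp [hi]
  · intro h
    exact absurd (Finset.mem_range.2 (by omega)) h

/-- Polarization on a coset, the form in which Baire supplies the vanishing. Substituting `j y + x`
for the variable and summing with weights `j ^ (p - 2)` leaves `-(k + 1) y (b + x) ^ k`; as `k + 1 <
p` is invertible, `y` moves into `w` and the degree drops by one. -/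
theorem mul_eq_zero_of_mem_pow (H : Submodule ℤ A) (b : A) {k : ℕ} (hk : k < p) (w : A)
    (h : ∀ y ∈ H, w * (b + y) ^ k = 0) : ∀ z ∈ H ^ k, w * z = 0 := by
  induction k generalizing w with
  | zero =>
    intro z _
    have := h 0 H.zero_mem
    rw [pow_zero, mul_one] at this
    rw [this, zero_mul]
  | succ k ih =>
    intro z hz
    rw [pow_succ'] at hz
    refine Submodule.mul_induction_on hz (fun y hy z hz => ?_) fun x y hx hy => by
      rw [mul_add, hx, hy, add_zero]
    rw [← mul_assoc]
    refine ih (by omega) (w * y) (fun x hx => ?_) z hz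
    have hsum := sum_zmod_mul_add_pow (p := p) (b + x) y hk
    have hzero : w * ∑ j : ZMod p, ZMod.castHom dvd_rfl A j ^ (p - 2) *
        (ZMod.castHom dvd_rfl A j * y + (b + x)) ^ (k + 1) = 0 := by
      rw [Finset.mul_sum]
      refine Finset.sum_eq_zero fun j _ => ?_
      have hj : ZMod.castHom dvd_rfl A j * y + x ∈ H := by
        refine H.add_mem ?_ hx
        obtain ⟨n, rfl⟩ := ZMod.natCast_zmod_surjective j
        rw [map_natCast, ← nsmul_eq_mul]
        exact H.nsmul_mem hy n
      have := h _ hj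
      linear_combination ZMod.castHom dvd_rfl A j ^ (p - 2) * this
    rw [hsum] at hzero
    have hunit : IsUnit ((k + 1 : ℕ) : A) := by
      have : IsUnit ((k + 1 : ℕ) : ZMod p) := by
        rw [ZMod.isUnit_iff_coprime]
        exact Nat.Coprime.symm ((Fact.out : p.Prime).coprime_iff_not_dvd.2
          fun hd => by have := Nat.le_of_dvd (by omega) hd; omega)
      simpa using this.map (ZMod.castHom dvd_rfl A)
    refine (hunit.mul_right_eq_zero).1 ?_
    linear_combination -hzero

end Polarization

/-! ### Compact rings of characteristic `p` with a nil ideal that is not nilpotent -/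

section Compact

variable {A : Type*} [CommRing A]

theorem restrictScalars_pow_le (I : Ideal A) (n : ℕ) :
    ((I.restrictScalars ℤ : Submodule ℤ A)) ^ n ≤ (I ^ n : Ideal A).restrictScalars ℤ := by
  induction n with
  | zero => intro x _; simp
  | succ n ih =>
    rw [pow_succ, pow_succ]
    exact Submodule.mul_le.2 fun x hx y hy => Ideal.mul_mem_mul (ih hx) hy

theorem pow_le_self_of_mul_le {K : Submodule ℤ A} (hK : K * K ≤ K) {n : ℕ} (hn : n ≠ 0) :
    K ^ n ≤ K := by
  obtain ⟨n, rfl⟩ := Nat.exists_eq_succ_of_ne_zero hn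
  induction n with
  | zero => simp
  | succ n ih =>
    rw [pow_succ]
    exact (mul_le_mul_left (ih (Nat.succ_ne_zero n)) K).trans hK

variable [TopologicalSpace A] [IsTopologicalRing A]

theorem isClosed_of_isOpen_ideal {U : Ideal A} (hU : IsOpen (U : Set A)) :
    IsClosed (U : Set A) :=
  AddSubgroup.isClosed_of_isOpen U.toAddSubgroup hU

variable [CompactSpace A]

/-- `A ⧸ U` is finite by compactness, hence Noetherian, so its nilradical is nilpotent. -/
theorem exists_nilradical_pow_le {U : Ideal A} (hU : IsOpen (U : Set A)) :
    ∃ l : ℕ, l ≠ 0 ∧ nilradical A ^ l ≤ U := by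
  have : Finite (A ⧸ U) := AddSubgroup.quotient_finite_of_isOpen U.toAddSubgroup hU
  obtain ⟨l, hl⟩ := IsNoetherianRing.isNilpotent_nilradical (A ⧸ U)
  refine ⟨l + 1, l.succ_ne_zero, (Ideal.pow_le_pow_right l.le_succ).trans ?_⟩
  have hmap : (nilradical A).map (Ideal.Quotient.mk U) ≤ nilradical (A ⧸ U) := by
    rw [Ideal.map_le_iff_le_comap]
    intro x hx
    exact (mem_nilradical.1 hx).map (Ideal.Quotient.mk U)
  have h := Ideal.pow_right_mono hmap l
  rw [hl, ← Ideal.map_pow, Ideal.map_le_iff_le_comap] at h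
  intro x hx
  exact Ideal.Quotient.eq_zero_iff_mem.1 (h hx)

variable [T2Space A]

/-- Frobenius is additive, so the kernels of its iterates are closed subgroups exhausting the
compact group of nilpotents, and Baire applies. -/
theorem exists_forall_pow_eq_zero (p : ℕ) [Fact p.Prime] [CharP A p]
    (hN : IsClosed (nilradical A : Set A)) : ∃ k : ℕ, ∀ x ∈ nilradical A, x ^ p ^ k = 0 := by
  have : CompactSpace (nilradical A).toAddSubgroup := isCompact_iff_compactSpace.1 hN.isCompact
  let H : ℕ → AddSubgroup (nilradical A).toAddSubgroup := fun k =>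
    (((iterateFrobenius A p k).toAddMonoidHom).comp (nilradical A).toAddSubgroup.subtype).ker
  have hH : ∀ k x, x ∈ H k ↔ (x : A) ^ p ^ k = 0 := fun k x => Iff.rfl
  have hpow : ∀ (x : A) (m n : ℕ), m ≤ n → x ^ m = 0 → x ^ n = 0 := fun x m n hmn h =>
    pow_eq_zero_of_le hmn h
  have hp := (Fact.out : p.Prime)
  obtain ⟨k, hk⟩ := exists_eq_top_of_monotone_isClosed H
    (fun m n hmn x hx => by
      rw [hH] at hx ⊢
      exact hpow _ _ _ (Nat.pow_le_pow_right hp.pos hmn) hx)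
    (fun k => isClosed_eq (by fun_prop : Continuous fun x : (nilradical A).toAddSubgroup =>
      (x : A) ^ p ^ k) continuous_const)
    (fun x => by
      obtain ⟨n, hn⟩ := mem_nilradical.1 x.2
      exact ⟨n, (hH n x).2 (hpow _ _ _ (Nat.lt_pow_self hp.one_lt).le hn)⟩)
  exact ⟨k, fun x hx => (hH k ⟨x, hx⟩).1 (hk ▸ AddSubgroup.mem_top _)⟩

/-- Either the Frobenius image of `S` is not nilpotent, and it has smaller nilexponent, or a power
of `S` falls into the Frobenius kernel on `S`, which then cannot be nilpotent and serves as `K`. -/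
theorem exists_nonnilpotent_of_nilexponent (p : ℕ) [Fact p.Prime] [CharP A p] (k : ℕ)
    (S : Submodule ℤ A) (hclosed : IsClosed (S : Set A)) (hmul : S * S ≤ S)
    (hnil : ¬ IsNilpotent S) (hk : ∀ x ∈ S, x ^ p ^ k = 0) :
    ∃ K : Submodule ℤ A, IsClosed (K : Set A) ∧ K * K ≤ K ∧ ¬ IsNilpotent K ∧
      ∀ x ∈ K, x ^ p = 0 := by
  induction k generalizing S with
  | zero =>
    refine absurd ⟨1, ?_⟩ hnil
    rw [pow_one, Submodule.zero_eq_bot, eq_bot_iff]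
    intro x hx
    simpa using hk x hx
  | succ k ih =>
    set φ : A →ₐ[ℤ] A := (frobenius A p).toIntAlgHom with hφ
    have hφx : ∀ x, φ.toLinearMap x = x ^ p := fun x => rfl
    by_cases hn : IsNilpotent (S.map φ.toLinearMap)
    · refine ⟨S ⊓ LinearMap.ker φ.toLinearMap, ?_, ?_, ?_, fun x hx => hx.2⟩
      · exact hclosed.inter (isClosed_eq (continuous_pow p) continuous_const)
      · refine Submodule.mul_le.2 fun x hx y hy => ⟨hmul (Submodule.mul_mem_mul hx.1 hy.1), ?_⟩
        change (x * y) ^ p = 0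
        rw [mul_pow, show x ^ p = 0 from hx.2, zero_mul]
      · rintro ⟨l, hl⟩
        obtain ⟨m, hm⟩ := hn
        -- `m + 1` rather than `m`: a power of `S` is contained in `S` only for nonzero exponents.
        refine hnil ⟨(m + 1) * l, ?_⟩
        rw [pow_mul, Submodule.zero_eq_bot, eq_bot_iff, ← Submodule.zero_eq_bot, ← hl]
        refine pow_le_pow_left' (le_inf (pow_le_self_of_mul_le hmul m.succ_ne_zero) ?_) l
        intro x hx
        have := Submodule.mem_map_of_mem (f := φ.toLinearMap) hx
        rwa [Submodule.map_pow, pow_succ, hm, zero_mul] at this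
    · refine ih (S.map φ.toLinearMap) ?_ ?_ hn ?_
      · rw [Submodule.map_coe]
        exact (hclosed.isCompact.image (continuous_pow p)).isClosed
      · rw [← Submodule.map_mul]
        exact Submodule.map_mono hmul
      · rintro _ ⟨x, hx, rfl⟩
        rw [hφx, ← pow_mul, ← pow_succ']
        exact hk x hx

/-- The element `u` annihilates no power of `K`. -/
def Persistent (K : Submodule ℤ A) (u : A) : Prop :=
  ∀ m : ℕ, ∃ x ∈ K ^ m, u * x ≠ 0

/-- Otherwise the closed conditions `u * a ^ (p - 1) * K ^ m = 0` cover `K ∩ U`, so by Baire one `m`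
works on a coset of `H = K ∩ U ∩ V n`. Polarization gives `u * K ^ m * H ^ (p - 1) = 0`, and `H`
contains a power `K ^ l`, so `u` annihilates a power of `K`. -/
theorem exists_persistent_mul_pow {p : ℕ} [Fact p.Prime] [CharP A p] {V : ℕ → Ideal A}
    (hVopen : ∀ n, IsOpen (V n : Set A)) (hV : ∀ W ∈ nhds (0 : A), ∃ n, (V n : Set A) ⊆ W)
    {K : Submodule ℤ A} (hclosed : IsClosed (K : Set A)) (hmul : K * K ≤ K)
    (hnil : ∀ x ∈ K, IsNilpotent x) {u : A} (hu : Persistent K u) {U : Ideal A}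
    (hU : IsOpen (U : Set A)) :
    ∃ a ∈ K, a ∈ U ∧ Persistent K (u * a ^ (p - 1)) := by
  by_contra! hcon
  let T : AddSubgroup A := (K ⊓ U.restrictScalars ℤ).toAddSubgroup
  have hT : IsClosed (T : Set A) := hclosed.inter (isClosed_of_isOpen_ideal hU)
  have : CompactSpace T := isCompact_iff_compactSpace.1 hT.isCompact
  let B : ℕ → Set T := fun m => ⋂ x ∈ K ^ m, {a : T | u * (a : A) ^ (p - 1) * x = 0}
  have hB : ∀ m (a : T), a ∈ B m ↔ ∀ x ∈ K ^ m, u * (a : A) ^ (p - 1) * x = 0 := by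
    intro m a
    simp [B]
  obtain ⟨m, b, hb⟩ := nonempty_interior_of_iUnion_of_closed (f := B)
    (fun m => isClosed_biInter fun x _ => isClosed_eq (by fun_prop) continuous_const)
    (Set.eq_univ_of_forall fun a => by
      have := hcon a a.2.1 a.2.2
      simp only [Persistent, not_forall, not_exists, not_and, not_not] at this
      obtain ⟨m, hm⟩ := this
      exact Set.mem_iUnion.2 ⟨m, (hB m a).2 hm⟩)
  have hb0 : (fun y : T => b + y) ⁻¹' B m ∈ nhds (0 : T) := by
    refine (continuous_const_add b).continuousAt.preimage_mem_nhds ?_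
    rw [add_zero]
    exact mem_interior_iff_mem_nhds.1 hb
  obtain ⟨W, hW, hWB⟩ := mem_nhds_induced _ _ _ |>.1 hb0
  obtain ⟨n, hn⟩ := hV W hW
  have hopen : IsOpen ((U ⊓ V n : Ideal A) : Set A) := hU.inter (hVopen n)
  obtain ⟨l, hl0, hl⟩ := exists_nilradical_pow_le hopen
  set H : Submodule ℤ A := K ⊓ (U ⊓ V n).restrictScalars ℤ with hH
  have hKl : K ^ l ≤ H := by
    refine le_inf (pow_le_self_of_mul_le hmul hl0) ?_
    have h1 : K ≤ (nilradical A).restrictScalars ℤ := fun x hx => mem_nilradical.2 (hnil x hx)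
    exact (pow_le_pow_left' h1 l).trans ((restrictScalars_pow_le _ l).trans
      fun x hx => hl hx)
  obtain ⟨z, hz, hne⟩ := hu (m + l * (p - 1))
  apply hne
  rw [pow_add] at hz
  refine Submodule.mul_induction_on hz (fun x hx y hy => ?_) fun x y hx hy => by
      rw [mul_add, hx, hy, add_zero]
  rw [← mul_assoc]
  rw [pow_mul] at hy
  refine mul_eq_zero_of_mem_pow (p := p) (k := p - 1) H b (by have := (Fact.out : p.Prime).pos; omega) (u * x)
    (fun y hy => ?_) y (pow_le_pow_left' hKl _ hy)
  have hyT : y ∈ T := ⟨hy.1, hy.2.1⟩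
  have := (hB m _).1 (hWB (a := ⟨y, hyT⟩) (hn hy.2.2)) x hx
  rw [mul_right_comm]
  exact this

theorem exists_independent_sequence {p : ℕ} [Fact p.Prime] [CharP A p] {V : ℕ → Ideal A}
    (hVopen : ∀ n, IsOpen (V n : Set A)) (hV : ∀ W ∈ nhds (0 : A), ∃ n, (V n : Set A) ⊆ W)
    {K : Submodule ℤ A} (hclosed : IsClosed (K : Set A)) (hmul : K * K ≤ K)
    (hnil : ∀ x ∈ K, IsNilpotent x) (hK : ¬ IsNilpotent K) :
    ∃ (a : ℕ → A) (U : ℕ → Ideal A), (∀ n, a n ∈ K) ∧ (∀ n, a n ∈ U n) ∧ Antitone U ∧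
      (∀ n, IsOpen (U n : Set A)) ∧ (∀ n, U (n + 1) ≤ V n) ∧
      ∀ n, ∏ i ∈ Finset.range (n + 1), a i ^ (p - 1) ∉ U (n + 1) := by
  let σ := {s : A × Ideal A // Persistent K s.1 ∧ IsOpen (s.2 : Set A)}
  have step : ∀ (n : ℕ) (s : σ), ∃ (a : A) (t : σ), a ∈ K ∧ a ∈ s.1.2 ∧
      t.1.1 = s.1.1 * a ^ (p - 1) ∧ t.1.2 ≤ s.1.2 ∧ t.1.2 ≤ V n ∧ t.1.1 ∉ t.1.2 := by
    rintro n ⟨⟨u, U⟩, hu, hU⟩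
    obtain ⟨a, haK, haU, ha⟩ := exists_persistent_mul_pow (p := p) hVopen hV hclosed hmul hnil hu hU
    have hne : u * a ^ (p - 1) ≠ 0 := by
      obtain ⟨x, _, hx⟩ := ha 0
      exact left_ne_zero_of_mul hx
    -- The next ideal is cut by `V n` to force convergence to `0` and by `V k` to exclude the
    -- nonzero product just formed.
    obtain ⟨k, hk⟩ := hV {u * a ^ (p - 1)}ᶜ (isOpen_compl_singleton.mem_nhds hne.symm)
    refine ⟨a, ⟨⟨u * a ^ (p - 1), U ⊓ V n ⊓ V k⟩, ha, ?_⟩, haK, haU, rfl, ?_, ?_, ?_⟩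
    · exact (hU.inter (hVopen n)).inter (hVopen k)
    · exact inf_le_left.trans inf_le_left
    · exact inf_le_left.trans inf_le_right
    · exact fun h => hk h.2 rfl
  choose a t h1 h2 h3 h4 h5 h6 using step
  have h0 : Persistent K (1 : A) := by
    intro m
    by_contra! h
    refine hK ⟨m, ?_⟩
    rw [Submodule.zero_eq_bot, eq_bot_iff]
    intro x hx
    simpa using h x hx
  let s : ℕ → σ := fun n => Nat.rec ⟨⟨1, ⊤⟩, h0, isOpen_univ⟩ (fun n s => t n s) n
  have hs : ∀ n, s (n + 1) = t n (s n) := fun n => rfl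
  have hprod : ∀ n, (s n).1.1 = ∏ i ∈ Finset.range n, a i (s i) ^ (p - 1) := by
    intro n
    induction n with
    | zero => rfl
    | succ n ih => rw [hs, h3, ih, Finset.prod_range_succ]
  refine ⟨fun n => a n (s n), fun n => (s n).1.2, fun n => h1 _ _, fun n => h2 _ _,
    antitone_nat_of_succ_le fun n => h4 _ _, fun n => (s n).2.2, fun n => h5 _ _, fun n => ?_⟩
  rw [← hprod]
  exact h6 _ _

end Compact

/-! ### Embedding the inverse limit into a compact ring -/

/-- The class in `F_0` of a polynomial without constant term. -/
def FreeNil.mk (p : ℕ) : PolyNoConst p →ₙ+* FreeNil p :=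
  quotientHom (powerIdeal p)

theorem FreeNil.mk_surjective (p : ℕ) : Function.Surjective (FreeNil.mk p) :=
  quotientHom_surjective _

theorem FreeNil.mk_eq_zero {p : ℕ} {f : PolyNoConst p} : FreeNil.mk p f = 0 ↔ f ∈ powerIdeal p :=
  quotientHom_eq_zero

/-- The quotient map `F_0 → F_0 / I_n`. -/
def FreeNilQuot.mk (p n : ℕ) : FreeNil p →ₙ+* FreeNilQuot p n :=
  quotientHom (tailIdeal p n)

theorem FreeNilQuot.mk_surjective (p n : ℕ) : Function.Surjective (FreeNilQuot.mk p n) :=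
  quotientHom_surjective _

theorem FreeNilQuot.mk_eq_iff {p n : ℕ} {g h : FreeNil p} :
    FreeNilQuot.mk p n g = FreeNilQuot.mk p n h ↔ g - h ∈ tailIdeal p n :=
  quotientHom_eq_iff

theorem FreeNilQuot.mk_eq_zero {p n : ℕ} {g : FreeNil p} :
    FreeNilQuot.mk p n g = 0 ↔ g ∈ tailIdeal p n :=
  quotientHom_eq_zero

theorem FreeNilQuot.transition_mk {p m n : ℕ} (h : m ≤ n) (g : FreeNil p) :
    FreeNilQuot.transition p h (FreeNilQuot.mk p n g) = FreeNilQuot.mk p m g :=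
  rfl

section Embedding

variable {R : Type*} [NonUnitalCommRing R] [TopologicalSpace R] {p : ℕ}

theorem eq_of_forall_sub_mem [T2Space R] {U : ℕ → TwoSidedIdeal R}
    (hU : ∀ W ∈ nhds (0 : R), ∃ n, (U n : Set R) ⊆ W) {x y : R} (h : ∀ n, x - y ∈ U n) :
    x = y := by
  by_contra hne
  obtain ⟨n, hn⟩ := hU {x - y}ᶜ (isOpen_compl_singleton.mem_nhds (sub_ne_zero.2 hne).symm)
  exact hn (h n) rfl

variable [IsTopologicalRing R]

theorem isClosed_of_isOpen_twoSidedIdeal {I : TwoSidedIdeal R} (hI : IsOpen (I : Set R)) :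
    IsClosed (I : Set R) :=
  AddSubgroup.isClosed_of_isOpen (AddSubgroup.ofClass I) hI

variable [CompactSpace R]

/-- Lifts of the coordinates of `f` give a decreasing sequence of nonempty closed cosets of the `U
n`; compactness provides a common point. -/
theorem exists_limit {U : ℕ → TwoSidedIdeal R} (hopen : ∀ n, IsOpen (U n : Set R))
    (hanti : Antitone U) (ψ : FreeNil p →ₙ+* R)
    (hψ : ∀ n g, g ∈ tailIdeal p n → ψ g ∈ U n) (f : FreeProfiniteNil p) :
    ∃ r : R, ∀ n, ∃ g, FreeNilQuot.mk p n g = f.1 n ∧ ψ g - r ∈ U n := by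
  choose g hg using fun n => FreeNilQuot.mk_surjective p n (f.1 n)
  have hsub : ∀ m n, m ≤ n → ψ (g m) - ψ (g n) ∈ U m := by
    intro m n hmn
    rw [← map_sub]
    refine hψ m _ (FreeNilQuot.mk_eq_iff.1 ?_)
    rw [hg m, ← FreeNilQuot.transition_mk hmn, hg n]
    exact (f.2 m n hmn).symm
  have hclosed : ∀ n, IsClosed {r : R | ψ (g n) - r ∈ U n} := fun n =>
    (isClosed_of_isOpen_twoSidedIdeal (hopen n)).preimage (continuous_const.sub continuous_id)
  obtain ⟨r, hr⟩ := IsCompact.nonempty_iInter_of_sequence_nonempty_isCompact_isClosed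
    (fun n => {r : R | ψ (g n) - r ∈ U n})
    (fun n r hr => by
      have h1 : ψ (g (n + 1)) - r ∈ U n := hanti n.le_succ hr
      have h2 := (U n).add_mem (hsub n (n + 1) n.le_succ) h1
      rwa [sub_add_sub_cancel] at h2)
    (fun n => ⟨ψ (g n), by
      change ψ (g n) - ψ (g n) ∈ U n
      rw [sub_self]
      exact (U n).zero_mem⟩)
    (hclosed 0).isCompact hclosed
  exact ⟨r, fun n => ⟨g n, hg n, Set.mem_iInter.1 hr n⟩⟩

/-- Because `hψ` is an equivalence, the limit map sends `f` into `U n` exactly when the `n`-th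
coordinate of `f` vanishes. This one fact yields injectivity, continuity both ways and closed range.
-/
theorem exists_closed_embedding [T2Space R] {U : ℕ → TwoSidedIdeal R} (hopen : ∀ n, IsOpen (U n : Set R))
    (hanti : Antitone U) (hU : ∀ W ∈ nhds (0 : R), ∃ n, (U n : Set R) ⊆ W)
    (ψ : FreeNil p →ₙ+* R) (hψ : ∀ n g, ψ g ∈ U n ↔ g ∈ tailIdeal p n) :
    ∃ S : NonUnitalSubring R, IsClosed (S : Set R) ∧
      ∃ e : FreeProfiniteNil p ≃+* S, Continuous e ∧ Continuous e.symm := by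
  choose Φ hΦ using exists_limit hopen hanti ψ fun n g => (hψ n g).2
  have huniq : ∀ (f : FreeProfiniteNil p) (r : R),
      (∀ n, ∃ g, FreeNilQuot.mk p n g = f.1 n ∧ ψ g - r ∈ U n) → Φ f = r := by
    intro f r hr
    refine eq_of_forall_sub_mem hU fun n => ?_
    obtain ⟨g, hg, hgU⟩ := hΦ f n
    obtain ⟨g', hg', hgU'⟩ := hr n
    have h := (hψ n (g' - g)).2 (FreeNilQuot.mk_eq_iff.1 (hg'.trans hg.symm))
    rw [map_sub] at h
    have h' := (U n).sub_mem ((U n).sub_mem hgU' hgU) h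
    have e : ψ g' - r - (ψ g - Φ f) - (ψ g' - ψ g) = Φ f - r := by abel
    rwa [e] at h'
  let F : FreeProfiniteNil p →ₙ+* R :=
    { toFun := Φ
      map_zero' := huniq 0 0 fun n => ⟨0, map_zero _, by simp [(U n).zero_mem]⟩
      map_add' := fun a b => huniq _ _ fun n => by
        obtain ⟨g, hg, hgU⟩ := hΦ a n
        obtain ⟨h, hh, hhU⟩ := hΦ b n
        refine ⟨g + h, by rw [map_add, hg, hh]; rfl, ?_⟩
        rw [map_add, add_sub_add_comm]
        exact (U n).add_mem hgU hhU
      map_mul' := fun a b => huniq _ _ fun n => by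
        obtain ⟨g, hg, hgU⟩ := hΦ a n
        obtain ⟨h, hh, hhU⟩ := hΦ b n
        refine ⟨g * h, by rw [map_mul, hg, hh]; rfl, ?_⟩
        have e : ψ (g * h) - Φ a * Φ b = (ψ g - Φ a) * ψ h + Φ a * (ψ h - Φ b) := by
          rw [map_mul, sub_mul, mul_sub]; abel
        rw [e]
        exact (U n).add_mem ((U n).mul_mem_right _ _ hgU) ((U n).mul_mem_left _ _ hhU) }
  have hF : ∀ f n, F f ∈ U n ↔ f.1 n = 0 := by
    intro f n
    obtain ⟨g, hg, hgU⟩ := hΦ f n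
    rw [← hg, FreeNilQuot.mk_eq_zero, ← hψ]
    constructor
    · intro h
      have := (U n).add_mem hgU h
      rwa [show ψ g - Φ f + F f = ψ g from sub_add_cancel _ _] at this
    · intro h
      have := (U n).sub_mem h hgU
      rwa [sub_sub_cancel] at this
  have hinj : Function.Injective F := by
    refine (injective_iff_map_eq_zero F).2 fun f hf => Subtype.ext (funext fun n => ?_)
    exact (hF f n).1 (hf ▸ (U n).zero_mem)
  have hclosed : IsClosed (Set.range F) := by
    refine isClosed_of_closure_subset fun r hr => ?_
    have hex : ∀ n, ∃ f, F f - r ∈ U n := by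
      intro n
      have hn : {x : R | x - r ∈ U n} ∈ nhds r := by
        refine ((hopen n).preimage (continuous_id.sub continuous_const)).mem_nhds ?_
        change r - r ∈ U n
        rw [sub_self]
        exact (U n).zero_mem
      obtain ⟨_, hx, f, rfl⟩ := mem_closure_iff_nhds.1 hr _ hn
      exact ⟨f, hx⟩
    choose f hf using hex
    have hcomp : ∀ m n, m ≤ n → (f n).1 m = (f m).1 m := by
      intro m n hmn
      rw [← sub_eq_zero]
      refine (hF (f n - f m) m).1 ?_
      have h := (U m).sub_mem (hanti hmn (hf n)) (hf m)
      rwa [sub_sub_sub_cancel_right, ← map_sub] at h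
    -- The preimage of `r` is the diagonal of its approximants, which is a coherent thread by
    -- `hcomp`.
    refine ⟨⟨fun n => (f n).1 n, fun m n hmn => ((f n).2 m n hmn).trans (hcomp m n hmn)⟩, ?_⟩
    refine huniq _ _ fun n => ?_
    obtain ⟨g, hg, hgU⟩ := hΦ (f n) n
    refine ⟨g, hg, ?_⟩
    have h := (U n).add_mem hgU (hf n)
    rwa [show ψ g - Φ (f n) + (F (f n) - r) = ψ g - r from sub_add_sub_cancel _ _ _] at h
  have hcont : Continuous F := by
    refine continuous_of_continuousAt_zero F ?_
    rw [ContinuousAt, map_zero]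
    intro W hW
    obtain ⟨n, hn⟩ := hU W hW
    have hopen0 : IsOpen {f : FreeProfiniteNil p | f.1 n = 0} :=
      (isOpen_discrete ({0} : Set (FreeNilQuot p n))).preimage
        ((continuous_apply n).comp continuous_subtype_val)
    exact Filter.mem_map.2 (Filter.mem_of_superset (hopen0.mem_nhds rfl)
      fun f hf => hn ((hF f n).2 hf))
  let e : FreeProfiniteNil p ≃+* NonUnitalRingHom.range F :=
    RingEquiv.ofBijective F.rangeRestrict
      ⟨fun x y h => hinj (congrArg Subtype.val h), F.rangeRestrict_surjective⟩
  have he : ∀ f, (e f : R) = F f := fun f => rfl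
  refine ⟨NonUnitalRingHom.range F, by rwa [NonUnitalRingHom.coe_range], e,
    hcont.subtype_mk _, ?_⟩
  refine continuous_induced_rng.2 (continuous_pi fun n => ?_)
  let c : NonUnitalRingHom.range F →+ FreeNilQuot p n :=
    ((Pi.evalAddMonoidHom _ n).comp
      (FreeProfiniteNil p).toAddSubgroup.subtype).comp (e.symm : _ →+ FreeProfiniteNil p)
  change Continuous c
  refine continuous_of_continuousAt_zero c ?_
  rw [ContinuousAt, map_zero, nhds_discrete (FreeNilQuot p n), Filter.tendsto_pure]
  have hmem : {y : NonUnitalRingHom.range F | (y : R) ∈ U n} ∈ nhds 0 :=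
    ((hopen n).preimage continuous_subtype_val).mem_nhds (U n).zero_mem
  filter_upwards [hmem] with y hy
  refine (hF (e.symm y) n).1 ?_
  rw [← he, e.apply_symm_apply]
  exact hy

end Embedding

/-! ### Evaluating polynomials at an independent sequence -/

section Evaluation

open MvPolynomial

variable {p : ℕ} [Fact p.Prime] {A : Type*} [CommRing A] [Algebra (ZMod p) A] {a : ℕ → A}

theorem pow_dvd_aeval_monomial (a : ℕ → A) {r : ℕ →₀ ℕ} {i k : ℕ} (h : k ≤ r i) :
    a i ^ k ∣ aeval a (monomial r (1 : ZMod p)) := by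
  refine ⟨aeval a (monomial (r - Finsupp.single i k) (1 : ZMod p)), ?_⟩
  have : monomial r (1 : ZMod p) = X i ^ k * monomial (r - Finsupp.single i k) 1 := by
    rw [X_pow_eq_monomial, monomial_mul, one_mul, add_tsub_cancel_of_le]
    exact Finsupp.single_le_iff.2 h
  rw [this, map_mul, map_pow, aeval_X]

/-- Over `𝔽_p` the power `P ^ p` is `P` with each variable raised to the `p`-th power, so evaluation
leaves only the constant term. -/
theorem aeval_pow_eq_zero (ha : ∀ i, a i ^ p = 0) {P : MvPolynomial ℕ (ZMod p)}
    (hP : constantCoeff P = 0) : (aeval a P) ^ p = 0 := by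
  rw [← map_pow, ← expand_zmod, ← AlgHom.comp_apply]
  have : (aeval a : MvPolynomial ℕ (ZMod p) →ₐ[ZMod p] A).comp (expand p) = aeval (fun _ : ℕ => (0 : A)) := by
    ext i
    simp [ha]
  rw [this, aeval_zero' , hP, map_zero]

/-- Among the offending monomials take `s` of least degree and multiply `P` by the complement of `s`
in `∏ x i ^ (p - 1)`, `i < n`. All other terms land in `U`, so the full product would too. For `n =
0` this product is `1`, and the vanishing constant term is used instead. -/
theorem exists_large_exponent_of_aeval_mem {n : ℕ} {U : Ideal A} (ha : ∀ i, a i ^ p = 0)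
    (haU : ∀ i, n ≤ i → a i ∈ U)
    (hprod : n ≠ 0 → ∏ i ∈ Finset.range n, a i ^ (p - 1) ∉ U) {P : MvPolynomial ℕ (ZMod p)}
    (hP : constantCoeff P = 0) (hPU : aeval a P ∈ U) {s : ℕ →₀ ℕ} (hs : s ∈ P.support) :
    (∃ i, p ≤ s i) ∨ ∃ i, n ≤ i ∧ 1 ≤ s i := by
  classical
  by_contra hbad
  let G := P.support.filter fun s => ¬ ((∃ i, p ≤ s i) ∨ ∃ i, n ≤ i ∧ 1 ≤ s i)
  obtain ⟨s, hsG, hmin⟩ := G.exists_min_image (fun s => s.degree)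
    ⟨s, Finset.mem_filter.2 ⟨hs, hbad⟩⟩
  obtain ⟨hs, hgood⟩ := Finset.mem_filter.1 hsG
  push Not at hgood
  obtain ⟨hlt, htail⟩ := hgood
  let q : ℕ →₀ ℕ := ∑ i ∈ Finset.range n, Finsupp.single i (p - 1)
  have hq : ∀ i, q i = if i < n then p - 1 else 0 := by
    intro i
    simp only [q, Finsupp.finsetSum_apply, Finsupp.single_apply, Finset.sum_ite_eq',
      Finset.mem_range]
  have hsq : s ≤ q := by
    intro i
    rw [hq]
    split_ifs with h
    · have := hlt i; omega
    · have := htail i (not_lt.1 h); omega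
  have hμq : aeval a (monomial q (1 : ZMod p)) = ∏ i ∈ Finset.range n, a i ^ (p - 1) := by
    have : monomial q (1 : ZMod p) = ∏ i ∈ Finset.range n, X i ^ (p - 1) := by
      simp only [q, X_pow_eq_monomial]
      rw [monomial_sum_one]
    rw [this, map_prod]
    simp
  have hn : n ≠ 0 := by
    rintro rfl
    have : s = 0 := by
      ext i
      have := htail i (Nat.zero_le i)
      simp only [Finsupp.coe_zero, Pi.zero_apply]
      omega
    rw [this, mem_support_iff] at hs
    exact hs hP
  apply hprod hn
  have hterm : ∀ r ∈ P.support, r ≠ s →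
      aeval a (monomial (r + (q - s)) (1 : ZMod p)) ∈ U := by
    intro r hr hrs
    by_cases hrG : (∃ i, p ≤ r i) ∨ ∃ i, n ≤ i ∧ 1 ≤ r i
    · rcases hrG with ⟨i, hi⟩ | ⟨i, hni, hi⟩
      · have := pow_dvd_aeval_monomial (p := p) a (r := r + (q - s)) (i := i) (k := p)
          (by rw [Finsupp.add_apply]; omega)
        rw [ha, zero_dvd_iff] at this
        rw [this]
        exact U.zero_mem
      · have := pow_dvd_aeval_monomial (p := p) a (r := r + (q - s)) (i := i) (k := 1)
          (by rw [Finsupp.add_apply]; omega)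
        rw [pow_one] at this
        exact U.mem_of_dvd this (haU i hni)
    · have hle := hmin r (Finset.mem_filter.2 ⟨hr, hrG⟩)
      push Not at hrG
      -- Minimality of the degree of `s` rules out `r ≤ s`. At such an `i` the exponent `r i + (p -
      -- 1 - s i)` is at least `p`, which kills the term.
      obtain ⟨i, hi⟩ : ∃ i, s i < r i := by
        by_contra! h
        have h' : r ≤ s := h
        have hdeg : (s - r).degree + r.degree = s.degree := by
          rw [← map_add, tsub_add_cancel_of_le h']
        have h0 : s - r = 0 := (Finsupp.degree_eq_zero_iff _).1 (by omega)
        exact hrs (le_antisymm h' (tsub_eq_zero_iff_le.1 h0))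
      have hin : i < n := by
        by_contra h
        have := hrG.2 i (not_lt.1 h)
        omega
      have := pow_dvd_aeval_monomial (p := p) a (r := r + (q - s)) (i := i) (k := p) (by
        rw [Finsupp.add_apply, Finsupp.tsub_apply, hq, if_pos hin]
        have := hlt i
        omega)
      rw [ha, zero_dvd_iff] at this
      rw [this]
      exact U.zero_mem
  have hmul : aeval a (P * monomial (q - s) 1) =
      ∑ r ∈ P.support, algebraMap (ZMod p) A (coeff r P) *
        aeval a (monomial (r + (q - s)) (1 : ZMod p)) := by
    conv_lhs => rw [P.as_sum, Finset.sum_mul, map_sum]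
    refine Finset.sum_congr rfl fun r _ => ?_
    rw [monomial_mul, mul_one, ← Algebra.smul_def, ← map_smul, smul_monomial, smul_eq_mul, mul_one]
  have hmem : aeval a (P * monomial (q - s) 1) ∈ U := by
    rw [map_mul]
    exact U.mul_mem_right _ hPU
  rw [hmul, ← Finset.add_sum_erase _ _ hs, add_tsub_cancel_of_le hsq, hμq] at hmem
  have hrest : ∑ r ∈ P.support.erase s, algebraMap (ZMod p) A (coeff r P) *
      aeval a (monomial (r + (q - s)) (1 : ZMod p)) ∈ U :=
    U.sum_mem fun r hr => U.mul_mem_left _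
      (hterm r (Finset.mem_of_mem_erase hr) (Finset.ne_of_mem_erase hr))
  have hlead := (U.add_mem_iff_left hrest).1 hmem
  have hunit : IsUnit (algebraMap (ZMod p) A (coeff s P)) :=
    (isUnit_iff_ne_zero.2 (mem_support_iff.1 hs)).map _
  exact (U.unit_mul_mem_iff_mem hunit).1 hlead

/-- The polynomials without constant term whose class lies in `I_n`, as a subgroup of the
polynomial ring. -/
def tailPolynomials (p n : ℕ) : AddSubgroup (MvPolynomial ℕ (ZMod p)) where
  carrier := {P | ∃ f : PolyNoConst p, f.1 = P ∧ FreeNil.mk p f ∈ tailIdeal p n}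
  zero_mem' := ⟨0, rfl, by rw [map_zero]; exact (tailIdeal p n).zero_mem⟩
  add_mem' := by
    rintro _ _ ⟨f, rfl, hf⟩ ⟨g, rfl, hg⟩
    exact ⟨f + g, rfl, by rw [map_add]; exact (tailIdeal p n).add_mem hf hg⟩
  neg_mem' := by
    rintro _ ⟨f, rfl, hf⟩
    exact ⟨-f, rfl, by rw [map_neg]; exact (tailIdeal p n).neg_mem hf⟩

theorem mul_monomial_mem_tailPolynomials {n : ℕ} {P : MvPolynomial ℕ (ZMod p)}
    (hP : P ∈ tailPolynomials p n) (t : ℕ →₀ ℕ) : P * monomial t 1 ∈ tailPolynomials p n := by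
  by_cases ht : t = 0
  · subst ht
    rwa [← C_apply, C_1, mul_one]
  · obtain ⟨f, rfl, hf⟩ := hP
    have hm : monomial t (1 : ZMod p) ∈
        RingHom.ker (constantCoeff : MvPolynomial ℕ (ZMod p) →+* ZMod p) := by
      rw [RingHom.mem_ker, constantCoeff_monomial, if_neg ht]
    let g : PolyNoConst p := ⟨monomial t 1, hm⟩
    refine ⟨f * g, rfl, ?_⟩
    have h := (tailIdeal p n).mul_mem_right (FreeNil.mk p f) (FreeNil.mk p g) hf
    rwa [← map_mul] at h

theorem monomial_mem_tailPolynomials {n : ℕ} {s : ℕ →₀ ℕ} (c : ZMod p)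
    (h : (∃ i, p ≤ s i) ∨ ∃ i, n ≤ i ∧ 1 ≤ s i) : monomial s c ∈ tailPolynomials p n := by
  obtain ⟨k, rfl⟩ := ZMod.natCast_zmod_surjective c
  have e : monomial s ((k : ℕ) : ZMod p) = k • monomial s 1 := by
    rw [smul_monomial, nsmul_eq_mul, mul_one]
  rw [e]
  refine (tailPolynomials p n).nsmul_mem ?_ k
  have hX : ∀ i, (X i : MvPolynomial ℕ (ZMod p)) ∈ RingHom.ker
      (constantCoeff : MvPolynomial ℕ (ZMod p) →+* ZMod p) := fun i => by simp [RingHom.mem_ker]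
  have hsplit : ∀ i k, k ≤ s i →
      monomial s (1 : ZMod p) = X i ^ k * monomial (s - Finsupp.single i k) 1 := by
    intro i k hk
    rw [X_pow_eq_monomial, monomial_mul, one_mul, add_tsub_cancel_of_le]
    exact Finsupp.single_le_iff.2 hk
  rcases h with ⟨i, hi⟩ | ⟨i, hni, hi⟩
  · rw [hsplit i p hi]
    refine mul_monomial_mem_tailPolynomials ?_ _
    have hm : (X i : MvPolynomial ℕ (ZMod p)) ^ p ∈ RingHom.ker
        (constantCoeff : MvPolynomial ℕ (ZMod p) →+* ZMod p) :=
      Ideal.pow_mem_of_mem _ (hX i) p (Fact.out : p.Prime).pos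
    refine ⟨⟨_, hm⟩, rfl, ?_⟩
    rw [FreeNil.mk_eq_zero.2 (TwoSidedIdeal.subset_span ⟨⟨X i, hX i⟩, rfl⟩)]
    exact (tailIdeal p n).zero_mem
  · rw [hsplit i 1 hi, pow_one]
    refine mul_monomial_mem_tailPolynomials ?_ _
    exact ⟨⟨X i, hX i⟩, rfl, TwoSidedIdeal.subset_span ⟨i, hni, rfl⟩⟩

theorem FreeNil.mk_mem_tailIdeal {n : ℕ} {f : PolyNoConst p}
    (h : ∀ s ∈ f.1.support, (∃ i, p ≤ s i) ∨ ∃ i, n ≤ i ∧ 1 ≤ s i) :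
    FreeNil.mk p f ∈ tailIdeal p n := by
  have : f.1 ∈ tailPolynomials p n := by
    rw [f.1.as_sum]
    exact AddSubgroup.sum_mem _ fun s hs => monomial_mem_tailPolynomials _ (h s hs)
  obtain ⟨g, hg, hgn⟩ := this
  rwa [← Subtype.ext hg]

/-- The homomorphism from the quotient by an ideal induced by one that kills the ideal. -/
def quotientLift {R S : Type*} [NonUnitalCommRing R] [NonUnitalCommRing S] (I : TwoSidedIdeal R)
    (f : R →ₙ+* S) (h : ∀ x ∈ I, f x = 0) : I.ringCon.Quotient →ₙ+* S where
  toFun := Quotient.lift f fun x y hxy => by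
    rw [← sub_eq_zero, ← map_sub]
    exact h _ ((TwoSidedIdeal.rel_iff I x y).1 hxy)
  map_zero' := map_zero f
  map_add' := by rintro ⟨x⟩ ⟨y⟩; exact map_add f x y
  map_mul' := by rintro ⟨x⟩ ⟨y⟩; exact map_mul f x y

variable {R : Type*} [NonUnitalCommRing R] [Module (ZMod p) R] [IsScalarTower (ZMod p) R R]
  [SMulCommClass (ZMod p) R R]

theorem exists_inr_eq_aeval (b : ℕ → R) (f : PolyNoConst p) :
    ∃ r : R, (r : Unitization (ZMod p) R) = aeval (fun i => (b i : Unitization (ZMod p) R)) f.1 := by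
  set P := aeval (fun i => (b i : Unitization (ZMod p) R)) f.1 with hP
  have hfst : P.fst = 0 := by
    have h : (Unitization.fstHom (ZMod p) R).comp
        (aeval fun i => (b i : Unitization (ZMod p) R)) = aeval (fun _ : ℕ => (0 : ZMod p)) := by
      ext i
      simp
    have h' := DFunLike.congr_fun h f.1
    rw [aeval_zero', f.2, map_zero] at h'
    exact h'
  exact ⟨P.snd, by ext <;> simp [hfst]⟩

/-- The universal property of `F_0`, computed in the unitization, where polynomial evaluation is
available; polynomials without constant term take values in `R`. -/
theorem exists_evaluation (b : ℕ → R) (hb : ∀ i, (b i : Unitization (ZMod p) R) ^ p = 0) :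
    ∃ ψ : FreeNil p →ₙ+* R, ∀ f : PolyNoConst p, (ψ (FreeNil.mk p f) : Unitization (ZMod p) R) =
      aeval (fun i => (b i : Unitization (ZMod p) R)) f.1 := by
  choose v hv using exists_inr_eq_aeval (p := p) b
  let χ : PolyNoConst p →ₙ+* R :=
    { toFun := v
      map_zero' := Unitization.inr_injective (R := ZMod p) (by rw [hv]; simp)
      map_add' := fun f g => Unitization.inr_injective (R := ZMod p) (by
        rw [Unitization.inr_add, hv, hv, hv]; exact map_add _ _ _)
      map_mul' := fun f g => Unitization.inr_injective (R := ZMod p) (by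
        rw [Unitization.inr_mul, hv, hv, hv]; exact map_mul _ _ _) }
  have hχ : powerIdeal p ≤ TwoSidedIdeal.ker χ := by
    refine TwoSidedIdeal.span_le.2 ?_
    rintro f ⟨g, hg⟩
    refine (TwoSidedIdeal.mem_ker χ).2 (Unitization.inr_injective (R := ZMod p) ?_)
    change (v f : Unitization (ZMod p) R) = _
    rw [hv, hg, map_pow, aeval_pow_eq_zero hb g.2, Unitization.inr_zero]
  exact ⟨quotientLift _ χ fun f hf => (TwoSidedIdeal.mem_ker χ).1 (hχ hf), hv⟩

end Evaluation

/-! ### Adjoining an identity to a compact ring of characteristic `p` -/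

section CompactUnitization

variable {p : ℕ} [Fact p.Prime] {R : Type u} [NonUnitalCommRing R] [Module (ZMod p) R]

theorem zmod_isScalarTower : IsScalarTower (ZMod p) R R where
  smul_assoc c x y := by
    obtain ⟨n, rfl⟩ := ZMod.natCast_zmod_surjective c
    simp only [Nat.cast_smul_eq_nsmul, smul_eq_mul, smul_mul_assoc]

theorem zmod_smulCommClass : SMulCommClass (ZMod p) R R where
  smul_comm c x y := by
    obtain ⟨n, rfl⟩ := ZMod.natCast_zmod_surjective c
    simp only [Nat.cast_smul_eq_nsmul, smul_eq_mul, mul_smul_comm]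

variable [IsScalarTower (ZMod p) R R] [SMulCommClass (ZMod p) R R]

instance charP_unitization : CharP (Unitization (ZMod p) R) p :=
  charP_of_injective_algebraMap (algebraMap (ZMod p) (Unitization (ZMod p) R)).injective p

theorem fst_eq_zero_of_isNilpotent {x : Unitization (ZMod p) R} (hx : IsNilpotent x) :
    x.fst = 0 :=
  (hx.map (Unitization.fstHom (ZMod p) R)).eq_zero

theorem exists_inr_of_isNilpotent {x : Unitization (ZMod p) R} (hx : IsNilpotent x) :
    ∃ r : R, (r : Unitization (ZMod p) R) = x :=
  ⟨x.snd, by ext <;> simp [fst_eq_zero_of_isNilpotent hx]⟩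

/-- The ideal of the unitization given by an ideal of the ring. -/
def inrIdeal (p : ℕ) [Fact p.Prime] [Module (ZMod p) R] [IsScalarTower (ZMod p) R R]
    [SMulCommClass (ZMod p) R R] (I : TwoSidedIdeal R) : Ideal (Unitization (ZMod p) R) where
  carrier := {x | x.fst = 0 ∧ x.snd ∈ I}
  zero_mem' := ⟨rfl, I.zero_mem⟩
  add_mem' := by
    rintro x y ⟨hx, hx'⟩ ⟨hy, hy'⟩
    exact ⟨by rw [Unitization.fst_add, hx, hy, add_zero], I.add_mem hx' hy'⟩
  smul_mem' := by
    rintro c x ⟨hx, hx'⟩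
    refine ⟨by rw [smul_eq_mul, Unitization.fst_mul, hx, mul_zero], ?_⟩
    rw [smul_eq_mul, Unitization.snd_mul, hx, zero_smul, add_zero]
    obtain ⟨n, hn⟩ := ZMod.natCast_zmod_surjective c.fst
    rw [← hn, Nat.cast_smul_eq_nsmul]
    exact I.add_mem (I.nsmul_mem n hx') (I.mul_mem_left _ _ hx')

theorem inr_mem_inrIdeal {I : TwoSidedIdeal R} {r : R} :
    (r : Unitization (ZMod p) R) ∈ inrIdeal p I ↔ r ∈ I :=
  ⟨fun h => h.2, fun h => ⟨rfl, h⟩⟩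

/-- The ideal of the ring cut out by an ideal of the unitization. -/
def inrComap (U : Ideal (Unitization (ZMod p) R)) : TwoSidedIdeal R :=
  TwoSidedIdeal.mk' {r | (r : Unitization (ZMod p) R) ∈ U}
    (by simp)
    (fun {x y} hx hy => by
      change ((x + y : R) : Unitization (ZMod p) R) ∈ U
      rw [Unitization.inr_add]; exact U.add_mem hx hy)
    (fun {x} hx => by
      change ((-x : R) : Unitization (ZMod p) R) ∈ U
      rw [Unitization.inr_neg]; exact U.neg_mem hx)
    (fun {x y} hy => by
      change ((x * y : R) : Unitization (ZMod p) R) ∈ U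
      rw [Unitization.inr_mul]; exact U.mul_mem_left _ hy)
    (fun {x y} hx => by
      change ((x * y : R) : Unitization (ZMod p) R) ∈ U
      rw [Unitization.inr_mul]; exact U.mul_mem_right _ hx)

theorem mem_inrComap {U : Ideal (Unitization (ZMod p) R)} {r : R} :
    r ∈ inrComap U ↔ (r : Unitization (ZMod p) R) ∈ U :=
  TwoSidedIdeal.mem_mk' _ _ _ _ _ _ _

variable [TopologicalSpace R] [IsTopologicalRing R] [CompactSpace R] [T2Space R]

theorem exists_topology_unitization :
    ∃ (_ : TopologicalSpace (Unitization (ZMod p) R)), IsTopologicalRing (Unitization (ZMod p) R) ∧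
      CompactSpace (Unitization (ZMod p) R) ∧ T2Space (Unitization (ZMod p) R) ∧
      Continuous (fun r : R => (r : Unitization (ZMod p) R)) ∧
      Continuous (fun x : Unitization (ZMod p) R => x.snd) ∧
      IsOpen {x : Unitization (ZMod p) R | x.fst = 0} := by
  let : TopologicalSpace (ZMod p) := ⊥
  have : DiscreteTopology (ZMod p) := ⟨rfl⟩
  have hsmul : Continuous fun q : ZMod p × R => q.1 • q.2 := by
    rw [continuous_prod_of_discrete_left]
    intro c
    obtain ⟨n, rfl⟩ := ZMod.natCast_zmod_surjective c
    simp only [Nat.cast_smul_eq_nsmul]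
    exact continuous_nsmul n
  let τ : TopologicalSpace (Unitization (ZMod p) R) :=
    TopologicalSpace.induced Unitization.equiv inferInstance
  have hind : Topology.IsInducing (Unitization.equiv : Unitization (ZMod p) R ≃ ZMod p × R) := ⟨rfl⟩
  let e : Unitization (ZMod p) R ≃ₜ ZMod p × R := Equiv.toHomeomorphOfIsInducing _ hind
  have hfst : Continuous fun x : Unitization (ZMod p) R => x.fst :=
    continuous_fst.comp hind.continuous
  have hsnd : Continuous fun x : Unitization (ZMod p) R => x.snd :=
    continuous_snd.comp hind.continuous
  refine ⟨τ, ?_, e.symm.compactSpace, e.symm.t2Space, ?_, hsnd, ?_⟩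
  · have hadd : ContinuousAdd (Unitization (ZMod p) R) := ⟨hind.continuous_iff.2
      (((hfst.comp continuous_fst).add (hfst.comp continuous_snd)).prodMk
        ((hsnd.comp continuous_fst).add (hsnd.comp continuous_snd)))⟩
    have hneg : ContinuousNeg (Unitization (ZMod p) R) := ⟨hind.continuous_iff.2
      (hfst.neg.prodMk hsnd.neg)⟩
    have hmul : ContinuousMul (Unitization (ZMod p) R) := ⟨hind.continuous_iff.2
      (((hfst.comp continuous_fst).mul (hfst.comp continuous_snd)).prodMk
        (((hsmul.comp ((hfst.comp continuous_fst).prodMk (hsnd.comp continuous_snd))).add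
          (hsmul.comp ((hfst.comp continuous_snd).prodMk (hsnd.comp continuous_fst)))).add
          ((hsnd.comp continuous_fst).mul (hsnd.comp continuous_snd))))⟩
    exact { }
  · exact hind.continuous_iff.2 (continuous_const.prodMk continuous_id)
  · exact (isOpen_discrete ({0} : Set (ZMod p))).preimage hfst

theorem nilradical_unitization (s : SmallProfiniteStructure R) :
    (nilradical (Unitization (ZMod p) R) : Set (Unitization (ZMod p) R)) =
      (fun r : R => (r : Unitization (ZMod p) R)) '' jacobsonRadical R := by
  ext x
  constructor
  · intro hx
    have hx' := mem_nilradical.1 hx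
    obtain ⟨r, rfl⟩ := exists_inr_of_isNilpotent hx'
    exact ⟨r, mem_jacobsonRadical_of_isNilpotent hx', rfl⟩
  · rintro ⟨r, hr, rfl⟩
    exact mem_nilradical.2 (isNilpotent_inr_of_mem_jacobsonRadical s hr)

theorem not_isNilpotent_nilradical (s : SmallProfiniteStructure R)
    (hs : ¬ IsNilpotentSet (jacobsonRadical R)) :
    ¬ IsNilpotent ((nilradical (Unitization (ZMod p) R)).restrictScalars ℤ :
      Submodule ℤ (Unitization (ZMod p) R)) := by
  rintro ⟨m, hm⟩
  refine hs ⟨m, fun r hr => Unitization.inr_injective (R := ZMod p) ?_⟩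
  have hmem : ∀ k, ∏ i ∈ Finset.range k, (r i : Unitization (ZMod p) R) ∈
      ((nilradical (Unitization (ZMod p) R)).restrictScalars ℤ :
        Submodule ℤ (Unitization (ZMod p) R)) ^ k := by
    intro k
    induction k with
    | zero => rw [pow_zero]; exact Submodule.one_le.1 le_rfl
    | succ k ih =>
      rw [Finset.prod_range_succ, pow_succ]
      refine Submodule.mul_mem_mul ih ?_
      exact mem_nilradical.2 (isNilpotent_inr_of_mem_jacobsonRadical s (hr k))
  have h := hmem (m + 1)
  rw [pow_succ, hm, zero_mul] at h
  rw [inr_prodUpTo]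
  exact h

theorem exists_freeProfiniteNil_embedding (s : SmallProfiniteStructure R)
    (hs : ¬ IsNilpotentSet (jacobsonRadical R)) :
    ∃ S : NonUnitalSubring R, IsClosed (S : Set R) ∧
      ∃ e : FreeProfiniteNil p ≃+* S, Continuous e ∧ Continuous e.symm := by
  obtain ⟨_, _, _, _, hinr, hsnd, hfst⟩ := exists_topology_unitization (p := p) (R := R)
  have hN : IsClosed (nilradical (Unitization (ZMod p) R) : Set (Unitization (ZMod p) R)) := by
    rw [nilradical_unitization s]
    exact (isClosed_jacobsonRadical.isCompact.image hinr).isClosed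
  obtain ⟨k, hk⟩ := exists_forall_pow_eq_zero p hN
  obtain ⟨K, hKclosed, hKmul, hKnil, hKp⟩ := exists_nonnilpotent_of_nilexponent p k
    ((nilradical (Unitization (ZMod p) R)).restrictScalars ℤ) hN
    (Submodule.mul_le.2 fun x _ y hy => (nilradical _).mul_mem_left x hy)
    (not_isNilpotent_nilradical s hs) hk
  have hne : s.basis.Nonempty := by
    obtain ⟨I, hI, _⟩ := s.basis_hasBasis.mem_iff.1 Filter.univ_mem
    exact ⟨I, hI⟩
  obtain ⟨I, hI⟩ := s.basis_countable.exists_eq_range hne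
  have hIbasis : ∀ W ∈ nhds (0 : R), ∃ n, (I n : Set R) ⊆ W := by
    intro W hW
    obtain ⟨J, hJ, hJW⟩ := s.basis_hasBasis.mem_iff.1 hW
    rw [hI] at hJ
    obtain ⟨n, rfl⟩ := hJ
    exact ⟨n, hJW⟩
  obtain ⟨a, U, haK, haU, hUanti, hUopen, hUV, hprod⟩ :=
    exists_independent_sequence (p := p) (V := fun n => inrIdeal p (I n))
      (fun n => hfst.inter ((s.basis_isOpen (I n) (hI ▸ Set.mem_range_self n)).preimage hsnd))
      (fun W hW => by
        obtain ⟨n, hn⟩ := hIbasis _ (hinr.continuousAt.preimage_mem_nhds (x := 0) hW)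
        refine ⟨n, fun x hx => ?_⟩
        have e : ((x.snd : R) : Unitization (ZMod p) R) = x := by
          ext
          · exact hx.1.symm
          · rfl
        rw [← e]
        exact hn hx.2)
      hKclosed hKmul (fun x hx => ⟨p, hKp x hx⟩) hKnil
  choose b hb using fun n => exists_inr_of_isNilpotent ⟨p, hKp (a n) (haK n)⟩
  have hbp : ∀ i, (b i : Unitization (ZMod p) R) ^ p = 0 := fun i => by
    rw [hb]; exact hKp _ (haK i)
  obtain ⟨ψ, hψ⟩ := exists_evaluation b hbp
  refine exists_closed_embedding (U := fun n => inrComap (U n)) (fun n => ?_)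
    (fun m n hmn r hr => mem_inrComap.2 (hUanti hmn (mem_inrComap.1 hr))) (fun W hW => ?_) ψ
    fun n g => ?_
  · convert (hUopen n).preimage hinr using 1
    ext r
    exact mem_inrComap
  · obtain ⟨n, hn⟩ := hIbasis W hW
    exact ⟨n + 1, fun r hr => hn (inr_mem_inrIdeal.1 (hUV n (mem_inrComap.1 hr)))⟩
  · have hbU : ∀ i, n ≤ i → (b i : Unitization (ZMod p) R) ∈ U n := fun i hi => by
      rw [hb]; exact hUanti hi (haU i)
    constructor
    · intro h
      obtain ⟨f, rfl⟩ := FreeNil.mk_surjective p g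
      rw [mem_inrComap, hψ] at h
      refine FreeNil.mk_mem_tailIdeal fun t ht =>
        exists_large_exponent_of_aeval_mem hbp hbU (fun hn => ?_) f.2 h ht
      obtain ⟨n, rfl⟩ := Nat.exists_eq_succ_of_ne_zero hn
      simp_rw [hb]
      exact hprod n
    · have hle : tailIdeal p n ≤ TwoSidedIdeal.comap ψ (inrComap (U n)) := by
        -- This inclusion needs only the generators: `b i` lies in `U n` for `i ≥ n`.
        refine TwoSidedIdeal.span_le.2 ?_
        rintro _ ⟨i, hi, rfl⟩
        refine (TwoSidedIdeal.mem_comap ψ).2 (mem_inrComap.2 ?_)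
        have := hψ ⟨MvPolynomial.X i, by simp [RingHom.mem_ker]⟩
        rw [MvPolynomial.aeval_X] at this
        exact this ▸ hbU i hi
      exact fun hg => (TwoSidedIdeal.mem_comap ψ).1 (hle hg)

end CompactUnitization

end SmallProfinite
end

theorem mainTheorem6
    (hfail : ¬ SmallProfinite.CommNilpotentRadicalConjecture.{u}) :
    ∃ (R : Type u) (_ : NonUnitalCommRing R) (_ : TopologicalSpace R) (_ : IsTopologicalRing R)
      (_ : CompactSpace R) (_ : T2Space R),
      Nonempty (SmallProfinite.SmallProfiniteStructure R) ∧
      ¬ SmallProfinite.IsNilpotentSet (SmallProfinite.jacobsonRadical R) ∧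
      ∃ p : ℕ, p.Prime ∧
        ∃ S : NonUnitalSubring R, IsClosed (S : Set R) ∧
          ∃ e : SmallProfinite.FreeProfiniteNil p ≃+* S, Continuous e ∧ Continuous e.symm := by
  obtain ⟨R, _, _, _, _, _, ⟨s⟩, hs, p, hp, hR⟩ :=
    SmallProfinite.exists_small_of_prime_characteristic hfail
  have : Fact p.Prime := ⟨hp⟩
  let : Module (ZMod p) R := AddCommGroup.zmodModule hR
  have : IsScalarTower (ZMod p) R R := SmallProfinite.zmod_isScalarTower
  have : SMulCommClass (ZMod p) R R := SmallProfinite.zmod_smulCommClass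
  exact ⟨R, inferInstance, inferInstance, inferInstance, inferInstance, inferInstance, ⟨s⟩, hs, p,
    hp, SmallProfinite.exists_freeProfiniteNil_embedding s hs⟩
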